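/- Let $\mathbb{N}=\{1,2,3,\dots\}$. For integers define $\partial(m_1,m_2)=m_2-m_1$ and, for $\ell>1$, $\partial(m_1,\dots,m_{2^\ell})=\partial(m_{2^{\ell-1}+1},\dots,m_{2^\ell})-\partial(m_1,\dots,m_{2^{\ell-1}})$. Let $\ell\in\mathbb{N}$. A set $E\subseteq\mathbb{N}$ is called $\Delta_\ell^*$ if for every (strictly) increasing sequence $(n_k)_{k\in\mathbb{N}}$ in $\mathbb{N}$ there exist $k_1<\cdots<k_{2^\ell}$ with $\partial(n_{k_1},\dots,n_{k_{2^\ell}})\in E$. For $r\ge 2^\ell$, a set $F\subseteq\mathbb{N}$ is called $\Delta_{\ell,r}$ if there is an $r$-term sequence $n_1,\dots,n_r$ of integers such that $\partial(n_{j_1},\dots,n_{j_{2^\ell}})\in F$ for all $1\le j_1<\cdots<j_{2^\ell}\le r$; a set $E\subseteq\mathbb{N}$ is called $\Delta_{\ell,r}^*$ if $E\cap F\neq\emptyset$ for every $\Delta_{\ell,r}$ set $F\subseteq\mathbb{N}$. For a real polynomial $v$ and $\epsilon>0$ put $\mathcal{R}(v,\epsilon)=\{n\in\mathbb{N} : \|v(n)\|<\epsilon\}$,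 where $\|x\|$ is the distance from $x$ to the nearest integer. A real polynomial $p$ is odd if $p(-x)=-p(x)$ (the zero polynomial is odd and counts as having degree at most $2\ell-1$). Theorem. Let $\ell\in\mathbb{N}$ and let $v$ be a real polynomial. The following are equivalent: (i) There exists a polynomial $w\in\mathbb{Q}[x]$ such that $w(0)\in\mathbb{Z}$ and $v-w$ is an odd polynomial of degree at most $2\ell-1$. (ii) For every $\epsilon>0$ there exists an integer $r\ge 2^\ell$ (which may depend on $\epsilon$) for which $\mathcal{R}(v,\epsilon)$ is $\Delta_{\ell,r}^*$. (iii) For every $\epsilon>0$, $\mathcal{R}(v,\epsilon)$ is $\Delta_\ell^*$. -/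

import Mathlib

open Polynomial

namespace OddPoly

/-- The iterated difference `∂(m₁, …, m_{2^ℓ})` of a `2^ℓ`-tuple of integers (indexed from `0`):
the `∂` of the second half minus the `∂` of the first half. For `ℓ = 1` it is `m₂ - m₁`
(the single-entry case `ℓ = 0` only starts the recursion). -/
def iterDiff : (ℓ : ℕ) → (Fin (2 ^ ℓ) → ℤ) → ℤ
  | 0, m => m ⟨0, by norm_num⟩
  | ℓ + 1, m =>
      iterDiff ℓ (fun i => m ⟨2 ^ ℓ + i.val, by have := i.isLt; rw [pow_succ]; omega⟩) -
        iterDiff ℓ (fun i => m ⟨i.val, by have := i.isLt; rw [pow_succ]; omega⟩)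

/-- The set `D_ℓ((n_k))` of `ℓ`-th differences `∂(n_{j₁}, …, n_{j_{2^ℓ}})`, `j₁ < ⋯ < j_{2^ℓ}`,
of a finite (`ι = Fin r`) or infinite (`ι = ℕ`) sequence of integers. -/
def diffSet {ι : Type} [Preorder ι] (ℓ : ℕ) (n : ι → ℤ) : Set ℤ :=
  {x | ∃ j : Fin (2 ^ ℓ) → ι, StrictMono j ∧ x = iterDiff ℓ (fun i => n (j i))}

/-- A set of positive integers, seen as a set of integers. -/
def toIntSet (E : Set ℕ+) : Set ℤ := {x | ∃ m ∈ E, ((m : ℕ) : ℤ) = x}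

/-- `E` is `Δ_ℓ^*`: for every increasing sequence `(n_k)` of positive integers there are
`k₁ < ⋯ < k_{2^ℓ}` with `∂(n_{k₁}, …, n_{k_{2^ℓ}}) ∈ E`. -/
def IsDeltaStar (ℓ : ℕ) (E : Set ℕ+) : Prop :=
  ∀ n : ℕ → ℕ+, StrictMono n →
    ∃ x ∈ diffSet ℓ (fun k => ((n k : ℕ) : ℤ)), x ∈ toIntSet E

/-- `E` is a `Δ_{ℓ,r}` set (meaningful for `r ≥ 2^ℓ`): a set of positive integers that contains
`D_ℓ((n_k)_{k=1}^r)` for some `r`-term sequence of integers. -/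
def IsDeltaFin (ℓ r : ℕ) (E : Set ℕ+) : Prop :=
  ∃ n : Fin r → ℤ, diffSet ℓ n ⊆ toIntSet E

/-- `E` is `Δ_{ℓ,r}^*` (meaningful for `r ≥ 2^ℓ`): it meets every `Δ_{ℓ,r}` set. -/
def IsDeltaFinStar (ℓ r : ℕ) (E : Set ℕ+) : Prop :=
  ∀ F : Set ℕ+, IsDeltaFin ℓ r F → (E ∩ F).Nonempty

/-- The distance from a real number to the nearest integer. -/
noncomputable def distNearestInt (x : ℝ) : ℝ := |x - (round x : ℤ)|

/-- `R(v, ε)`, the set of positive integers `n` with `‖v(n)‖ < ε`. -/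
def returnSet (v : ℝ[X]) (ε : ℝ) : Set ℕ+ :=
  {n | distNearestInt (v.eval ((n : ℕ) : ℝ)) < ε}

/-- A real polynomial `p` is odd if `p(-x) = -p(x)`. -/
def IsOddPoly (p : ℝ[X]) : Prop := p.comp (-X) = -p

end OddPoly

/-!
The proof studies iterated differences along ultrafilters. If `u` is an ultrafilter on a commutative
ring `A`, let `diffLaw ℓ u` be the ultrafilter of `∂(x₁, …, x_{2^ℓ})` when the `xᵢ` are drawn
successively along `u`. For additive `ψ : A →+ ℝ/ℤ`, the limit of `a ↦ ψ (b * a ^ d)` along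
`diffLaw ℓ u` is again additive in `b`, so the `d`-th moment is an operator `M_ℓ(d)` on `A →+ ℝ/ℤ`.
Iterated limits are composites of such operators, and the binomial expansion of `(y - x) ^ d` gives
`M_{ℓ+1}(d) = ∑_{i+j=d} (-1)^i (d choose i) M_ℓ(i) M_ℓ(j)` (`isMomentSeq_diffMoment`), where the
factors do not commute. Everything else about differences is algebra with this recursion.

* If `d ≤ 2ℓ - 1` is odd, then `M_ℓ(d) = 0` (`IsMomentSeq.eq_zero_of_odd`): by induction only the
  terms `M(0) M(d)` and `-M(d) M(0)` survive. So odd monomials of degree at most `2ℓ - 1` vanish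
  modulo `1` along iterated differences. This covers rational polynomials with integral constant
  term too, since the monomial `x / q` makes the differences divisible by `q`. The statement about
  finite sequences follows by taking `A = ℕ → ℤ` and letting `ψ` be an ultralimit over a sequence
  of longer and longer counterexamples (`exists_isDeltaFinStar`).
* A property of `diffLaw ℓ u`-most integers holds for all iterated differences of some increasing
  sequence (`exists_strictMono_forall_iterDiff`), a Ramsey type statement. With the property of
  being positive it passes from finite to infinite sequences (`IsDeltaStar.of_isDeltaFinStar`).
  With the property `ε ≤ ‖v(a)‖` it shows that if all sets `returnSet v ε` are `Δ_ℓ^*`, then `v`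
  vanishes modulo `1` along all iterated differences of large integers.
* The polynomials that vanish in this sense form a group stable under `x ↦ 2x`, so if one of them
  has an irrational coefficient in degree `d`, the group contains a monomial `α x ^ d` with `α`
  irrational (`exists_monomial_mem`). This is impossible if `d > 0` is even or `d ≥ 2ℓ + 1`: by
  Weyl's theorem (`exists_ultrafilter_tendsto`) the limits along `u` of finitely many `γ n ^ e`
  modulo `1` can be prescribed when the `γ`'s and `1` are independent over `ℚ`. For even `d` let
  `α n ^ d` tend to `α` and the lower powers to `0`, so that `M_ℓ(d)` acts as `2 ^ ℓ`. For
  `d = 2ℓ + f` with `f` odd, let `n ^ 2` carry `α = γ₀` to `γ₁`, …, `γ_ℓ` and `n ^ f` carry `γ_ℓ`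
  back to `α`; then `M_ℓ(d)` multiplies by a nonzero integer (`IsChain.exists_smul`).

Weyl's theorem is proved for Cesàro means along an ultrafilter, which are shift invariant means of
bounded sequences; van der Corput's lemma then becomes a short computation.
-/

namespace OddPoly

open Filter Topology Finset

/-! ### Iterated differences along an ultrafilter -/

/-- The law of `∂(x₁, …, x_{2^ℓ})` when the variables are drawn successively along the
ultrafilter `u`, the first one being the outermost. -/
def diffLaw {A : Type*} [AddCommGroup A] : ℕ → Ultrafilter A → Ultrafilter A
  | 0, u => u
  | ℓ + 1, u => (diffLaw ℓ u).bind fun x => (diffLaw ℓ u).map fun y => y - x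

theorem eventually_diffLaw_succ {A : Type*} [AddCommGroup A] {ℓ : ℕ} {u : Ultrafilter A}
    {P : A → Prop} : (∀ᶠ a in (diffLaw (ℓ + 1) u : Filter A), P a) ↔
      ∀ᶠ x in (diffLaw ℓ u : Filter A), ∀ᶠ y in (diffLaw ℓ u : Filter A), P (y - x) :=
  Iff.rfl

theorem diffLaw_map {A B : Type*} [AddCommGroup A] [AddCommGroup B] (f : A →+ B)
    (ℓ : ℕ) (u : Ultrafilter A) : diffLaw ℓ (u.map f) = (diffLaw ℓ u).map f := by
  induction ℓ with
  | zero => rfl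
  | succ ℓ ih =>
    ext s
    change (∀ᶠ x in (diffLaw ℓ (u.map f) : Filter B),
        ∀ᶠ y in (diffLaw ℓ (u.map f) : Filter B), y - x ∈ s) ↔
      ∀ᶠ x in (diffLaw ℓ u : Filter A), ∀ᶠ y in (diffLaw ℓ u : Filter A), f (y - x) ∈ s
    simp only [ih, Ultrafilter.coe_map, eventually_map, map_sub]

theorem eventually_diffLaw_gt {u : Ultrafilter ℤ} (hu : (u : Filter ℤ) ≤ atTop) (ℓ : ℕ) (N : ℤ) :
    ∀ᶠ a in (diffLaw ℓ u : Filter ℤ), N < a := by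
  induction ℓ generalizing N with
  | zero => exact hu (eventually_gt_atTop N)
  | succ ℓ ih =>
    rw [eventually_diffLaw_succ]
    refine Eventually.of_forall fun x => ?_
    filter_upwards [ih (N + x)] with y hy
    omega

/-! ### Moments of an ultrafilter as operators -/

section Moments

theorem tendsto_lim_map {ι T : Type*} [TopologicalSpace T] [CompactSpace T] (u : Ultrafilter ι)
    (f : ι → T) : Tendsto f u (𝓝 (u.map f).lim) :=
  (u.map f).le_nhds_lim

theorem lim_map_eq {ι T : Type*} [TopologicalSpace T] [CompactSpace T] [T2Space T]
    {u : Ultrafilter ι} {f : ι → T} {t : T} (h : Tendsto f u (𝓝 t)) : (u.map f).lim = t :=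
  tendsto_nhds_unique (tendsto_lim_map u f) h

variable {ι A T : Type*} [CommRing A] [AddCommGroup T] [TopologicalSpace T]
  [IsTopologicalAddGroup T] [CompactSpace T] [T2Space T]

/-- The moment of `g` along `u`: the operator `ψ ↦ (a ↦ lim_{k → u} ψ (a * g k))` on the additive
maps from the ring `A` to the compact group `T`. Composing moments amounts to taking iterated
limits, so the moments of different orders do not commute in general. -/
noncomputable def moment (u : Ultrafilter ι) (g : ι → A) : AddMonoid.End (A →+ T) :=
  AddMonoidHom.mk'
    (fun ψ => AddMonoidHom.mk' (fun a => (u.map fun k => ψ (a * g k)).lim) (by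
      intro a b
      refine lim_map_eq ?_
      simp only [add_mul, map_add]
      exact (tendsto_lim_map u _).add (tendsto_lim_map u _)))
    (by
      intro ψ φ
      ext a
      exact lim_map_eq ((tendsto_lim_map u fun k => ψ (a * g k)).add (tendsto_lim_map u _)))

theorem tendsto_moment (u : Ultrafilter ι) (g : ι → A) (ψ : A →+ T) (a : A) :
    Tendsto (fun k => ψ (a * g k)) u (𝓝 (moment u g ψ a)) :=
  tendsto_lim_map u _

theorem moment_apply_eq {u : Ultrafilter ι} {g : ι → A} {ψ : A →+ T} {a : A} {t : T}
    (h : Tendsto (fun k => ψ (a * g k)) u (𝓝 t)) : moment u g ψ a = t :=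
  lim_map_eq h

theorem moment_one (u : Ultrafilter ι) :
    moment u (fun _ => (1 : A)) = (1 : AddMonoid.End (A →+ T)) := by
  ext ψ a
  exact moment_apply_eq (by simp)

theorem moment_sum {κ : Type*} (u : Ultrafilter ι) (s : Finset κ) (c : κ → ℤ) (g : κ → ι → A) :
    (moment u (fun k => ∑ i ∈ s, c i • g i k) : AddMonoid.End (A →+ T)) =
      ∑ i ∈ s, c i • moment u (g i) := by
  ext ψ a
  have h : (∑ i ∈ s, c i • (moment u (g i) : AddMonoid.End (A →+ T))) ψ a =
      ∑ i ∈ s, c i • moment u (g i) ψ a := by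
    induction s using Finset.cons_induction with
    | empty => rfl
    | cons i s hi ih => rw [sum_cons, sum_cons, ← ih]; rfl
  rw [h]
  refine moment_apply_eq ?_
  simp only [mul_sum, map_sum, mul_smul_comm, map_zsmul]
  exact tendsto_finsetSum s fun i _ => (tendsto_moment u (g i) ψ a).zsmul (c i)

/-- The moment of a product of functions of successive independent variables is the composite of
the moments. -/
theorem moment_bind_prod (u v : Ultrafilter ι) (g h : ι → A) :
    (moment (u.bind fun x => v.map fun y => (x, y)) (fun p => g p.1 * h p.2) :
      AddMonoid.End (A →+ T)) = moment u g * moment v h := by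
  ext ψ a
  refine moment_apply_eq ?_
  change Tendsto _ _ (𝓝 (moment u g (moment v h ψ) a))
  rw [tendsto_nhds]
  intro s hs hmem
  change ∀ᶠ x in (u : Filter ι), ∀ᶠ y in (v : Filter ι), ψ (a * (g x * h y)) ∈ s
  filter_upwards [(tendsto_moment u g (moment v h ψ) a).eventually (hs.mem_nhds hmem)] with x hx
  filter_upwards [(tendsto_moment v h ψ (a * g x)).eventually (hs.mem_nhds hx)] with y hy
  rwa [← mul_assoc]

/-- The operator of `d`-th moments of the iterated differences. -/
noncomputable def diffMoment (T : Type*) [AddCommGroup T] [TopologicalSpace T]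
    [IsTopologicalAddGroup T] [CompactSpace T] [T2Space T]
    (u : Ultrafilter A) (ℓ d : ℕ) : AddMonoid.End (A →+ T) :=
  moment (diffLaw ℓ u) fun a => a ^ d

end Moments

/-- A double sequence of elements of a ring obeys the recursion satisfied by the moments of iterated
differences: the binomial expansion of `(y - x) ^ d` with the powers of `x` on the left. -/
def IsMomentSeq {R : Type*} [Ring R] (M : ℕ → ℕ → R) : Prop :=
  M 0 0 = 1 ∧ ∀ ℓ d, M (ℓ + 1) d =
    ∑ m ∈ antidiagonal d, ((-1) ^ m.1 * (d.choose m.1) : ℤ) • (M ℓ m.1 * M ℓ m.2)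

theorem isMomentSeq_diffMoment {A T : Type*} [CommRing A] [AddCommGroup T] [TopologicalSpace T]
    [IsTopologicalAddGroup T] [CompactSpace T] [T2Space T] (u : Ultrafilter A) :
    IsMomentSeq (diffMoment T u) := by
  constructor
  · simp only [diffMoment, pow_zero]
    exact moment_one u
  · intro ℓ d
    calc diffMoment T u (ℓ + 1) d
        = moment ((diffLaw ℓ u).bind fun x => (diffLaw ℓ u).map fun y => (x, y))
            (fun p : A × A => (p.2 - p.1) ^ d) := rfl
      _ = moment ((diffLaw ℓ u).bind fun x => (diffLaw ℓ u).map fun y => (x, y))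
            (fun p : A × A => ∑ m ∈ antidiagonal d,
              ((-1) ^ m.1 * (d.choose m.1) : ℤ) • (p.1 ^ m.1 * p.2 ^ m.2)) := by
          congr 1
          ext p
          rw [sub_eq_neg_add, (Commute.all (-p.1) p.2).add_pow']
          refine sum_congr rfl fun m _ => ?_
          rw [neg_pow, nsmul_eq_mul, zsmul_eq_mul]
          push_cast
          ring
      _ = _ := by
          rw [moment_sum]
          exact sum_congr rfl fun m _ => by
            rw [moment_bind_prod (g := fun x => x ^ m.1) (h := fun y => y ^ m.2)]; rfl

/-! ### The algebra of moment sequences -/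

section MomentSeq

variable {R : Type*} [Ring R] {M : ℕ → ℕ → R}

theorem IsMomentSeq.zero (hM : IsMomentSeq M) (ℓ : ℕ) : M ℓ 0 = 1 := by
  induction ℓ with
  | zero => exact hM.1
  | succ ℓ ih => rw [hM.2]; simp [ih]

/-- In `∑ (-1)^i (d.choose i) M_i M_j` with `i + j = d` odd, one of `i`, `j` is odd, so by induction
only the terms `i = d` and `j = d` can survive, and these two cancel. -/
theorem IsMomentSeq.eq_zero_of_odd (hM : IsMomentSeq M) {ℓ d : ℕ} (hd : Odd d)
    (hdl : d + 1 ≤ 2 * ℓ) : M ℓ d = 0 := by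
  induction ℓ generalizing d with
  | zero => omega
  | succ ℓ ih =>
    have hd0 : d ≠ 0 := by rintro rfl; simp at hd
    rw [hM.2, sum_eq_add (0, d) (d, 0) (by simp [hd0.symm])]
    · simp [hM.zero, hd.neg_one_pow]
    · rintro ⟨i, j⟩ hm ⟨h1, h2⟩
      rw [Finset.HasAntidiagonal.mem_antidiagonal] at hm
      simp only at hm ⊢
      rw [Nat.odd_iff] at hd
      have hi : i ≠ 0 := by rintro rfl; apply h1; ext <;> simp_all
      have hj : j ≠ 0 := by rintro rfl; apply h2; ext <;> simp_all
      rcases Nat.even_or_odd i with hi' | hi'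
      · rw [Nat.even_iff] at hi'
        rw [ih (d := j) (Nat.odd_iff.2 (by omega)) (by omega), mul_zero, smul_zero]
      · have := Nat.odd_iff.1 hi'
        rw [ih (d := i) hi' (by omega), zero_mul, smul_zero]
    · simp
    · simp

end MomentSeq

section MomentSeqAction

variable {X : Type*} [AddCommGroup X] {M : ℕ → ℕ → AddMonoid.End X}

theorem IsMomentSeq.succ_apply (hM : IsMomentSeq M) (ℓ d : ℕ) (x : X) : M (ℓ + 1) d x =
    ∑ m ∈ antidiagonal d, ((-1) ^ m.1 * (d.choose m.1) : ℤ) • M ℓ m.1 (M ℓ m.2 x) := by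
  rw [hM.2]
  induction antidiagonal d using Finset.cons_induction with
  | empty => rfl
  | cons i s hi ih => rw [sum_cons, sum_cons, ← ih]; rfl

/-- If `x` is killed by the moments of degrees `1, …, d - 1`, then every level doubles the moment
of even degree `d`. -/
theorem IsMomentSeq.apply_of_even (hM : IsMomentSeq M) {d : ℕ} (hd : Even d) (hd0 : d ≠ 0) {x : X}
    (hx : ∀ e, e ≠ 0 → e < d → M 0 e x = 0) (ℓ : ℕ) :
    (∀ e, e ≠ 0 → e < d → M ℓ e x = 0) ∧ M ℓ d x = (2 ^ ℓ : ℤ) • M 0 d x := by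
  induction ℓ with
  | zero => exact ⟨hx, by simp⟩
  | succ ℓ ih =>
    constructor
    · intro e he hed
      rw [hM.succ_apply]
      refine sum_eq_zero fun m hm => ?_
      rw [HasAntidiagonal.mem_antidiagonal] at hm
      rcases eq_or_ne m.2 0 with h | h
      · rw [h, hM.zero, show m.1 = e by omega]
        simp [ih.1 e he hed]
      · rw [ih.1 m.2 h (by omega), map_zero, smul_zero]
    · rw [hM.succ_apply, sum_eq_add (0, d) (d, 0) (by simp [hd0.symm])]
      · simp [hM.zero, hd.neg_one_pow, ih.2, pow_succ, mul_two, add_smul]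
      · rintro ⟨i, j⟩ hm ⟨h1, h2⟩
        rw [HasAntidiagonal.mem_antidiagonal] at hm
        simp only at hm ⊢
        have hi : i ≠ 0 := by rintro rfl; apply h1; ext <;> simp_all
        have hj : j ≠ 0 := by rintro rfl; apply h2; ext <;> simp_all
        rw [ih.1 j hj (by omega), map_zero, smul_zero]
      · simp
      · simp

/-- A chain `s 0, …, s ℓ` along which the second moment at level `0` acts as a shift, while all
other moments of small degree vanish. A vector `s i` has to be followed by moments of total degree
`d - 2 * i` at most. -/
structure IsChain (M : ℕ → ℕ → AddMonoid.End X) (ℓ d : ℕ) (s : ℕ → X) : Prop where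
  shift : ∀ i, 2 + 2 * i < d → M 0 2 (s i) = s (i + 1)
  kill : ∀ i e, e ≠ 0 → e ≠ 2 → e + 2 * i < d → M 0 e (s i) = 0
  eq_zero : ∀ i, ℓ < i → s i = 0

theorem IsChain.apply_mem {ℓ d : ℕ} {s : ℕ → X} (hM : IsMomentSeq M) (hs : IsChain M ℓ d s)
    (t : ℕ) : ∀ i e, e + 2 * i < d → (Odd e → M t e (s i) = 0) ∧
      ∀ j, e = 2 * j → M t e (s i) ∈ AddSubgroup.zmultiples (s (i + j)) := by
  induction t with
  | zero =>
    intro i e he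
    refine ⟨fun h => hs.kill i e (by rintro rfl; simp at h)
      (by rintro rfl; exact absurd h (by decide)) he, ?_⟩
    rintro j rfl
    rcases eq_or_ne j 0 with rfl | h0
    · simp [hM.zero]
    rcases eq_or_ne j 1 with rfl | h1
    · rw [mul_one, hs.shift i (by omega)]
      exact AddSubgroup.mem_zmultiples _
    · rw [hs.kill i _ (by omega) (by omega) he]
      exact zero_mem _
  | succ t ih =>
    intro i e he
    constructor
    · intro hodd
      rw [hM.succ_apply]
      refine sum_eq_zero fun m hm => ?_
      rw [HasAntidiagonal.mem_antidiagonal] at hm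
      rcases Nat.even_or_odd m.2 with h | h
      · obtain ⟨k, hk⟩ := h.exists_two_nsmul
        rw [nsmul_eq_mul, Nat.cast_ofNat] at hk
        obtain ⟨c, hc⟩ := (ih i m.2 (by omega)).2 k hk
        rw [Nat.odd_iff] at hodd
        rw [← hc, map_zsmul, (ih (i + k) m.1 (by omega)).1 (Nat.odd_iff.2 (by omega)),
          smul_zero, smul_zero]
      · rw [(ih i m.2 (by omega)).1 h, map_zero, smul_zero]
    · rintro j rfl
      rw [hM.succ_apply]
      refine sum_mem fun m hm => zsmul_mem ?_ _
      rw [HasAntidiagonal.mem_antidiagonal] at hm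
      rcases Nat.even_or_odd m.2 with h | h
      · obtain ⟨k, hk⟩ := h.exists_two_nsmul
        rw [nsmul_eq_mul, Nat.cast_ofNat] at hk
        obtain ⟨c, hc⟩ := (ih i m.2 (by omega)).2 k hk
        rw [← hc, map_zsmul]
        have := (ih (i + k) m.1 (by omega)).2 (j - k) (by omega)
        rw [show i + k + (j - k) = i + j by omega] at this
        exact zsmul_mem this c
      · rw [(ih i m.2 (by omega)).1 h, map_zero]
        exact zero_mem _

theorem IsChain.apply_two {ℓ d : ℕ} {s : ℕ → X} (hM : IsMomentSeq M) (hs : IsChain M ℓ d s)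
    (t i : ℕ) (hi : 2 + 2 * i < d) : M t 2 (s i) = (2 ^ t : ℤ) • s (i + 1) := by
  induction t with
  | zero => simp [hs.shift i hi]
  | succ t ih =>
    rw [hM.succ_apply]
    have h1 : M t 1 (s i) = 0 := (hs.apply_mem hM t i 1 (by omega)).1 odd_one
    simp [Finset.Nat.antidiagonal_succ, hM.zero, ih, h1, pow_succ, mul_two, add_smul]

/-- At level `ℓ`, the moment of odd degree `2 * ℓ + f` of the start of a chain of length `ℓ` is a
nonzero multiple of the moment of degree `f` of its end. At level `t` the moments of degree
`2 * j + f` of `s (ℓ - j)` vanish for `j < t`; in the recursion for `j = t` the two extreme terms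
cancel and only the term that moves one step along the chain survives. -/
theorem IsChain.exists_smul {ℓ f : ℕ} {s : ℕ → X} (hM : IsMomentSeq M) (hf : Odd f)
    (hs : IsChain M ℓ (2 * ℓ + f) s) :
    ∃ c : ℤ, c ≠ 0 ∧ M ℓ (2 * ℓ + f) (s 0) = c • M 0 f (s ℓ) := by
  have hf' := Nat.odd_iff.1 hf
  suffices H : ∀ t ≤ ℓ, (∀ j < t, M t (2 * j + f) (s (ℓ - j)) = 0) ∧
      ∃ c : ℤ, c ≠ 0 ∧ M t (2 * t + f) (s (ℓ - t)) = c • M 0 f (s ℓ) by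
    simpa using (H ℓ le_rfl).2
  intro t
  induction t with
  | zero => exact fun _ => ⟨by simp, 1, one_ne_zero, by simp⟩
  | succ t ih =>
    intro htl
    obtain ⟨ih1, c, hc0, hc⟩ := ih (by omega)
    have key : ∀ j ≤ t + 1, ∀ a b, a + b = 2 * j + f → a ≠ 0 → b ≠ 0 → (j = t + 1 → b ≠ 2) →
        M t a (M t b (s (ℓ - j))) = 0 := by
      intro j hj a b hab ha hb hj2
      rcases Nat.even_or_odd b with h | h
      · obtain ⟨k, hk⟩ := h.exists_two_nsmul
        rw [nsmul_eq_mul, Nat.cast_ofNat] at hk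
        obtain ⟨m, hm⟩ := (hs.apply_mem hM t (ℓ - j) b (by omega)).2 k hk
        rw [← hm, map_zsmul]
        rcases lt_or_ge j k with hjk | hjk
        · rw [hs.eq_zero _ (by omega), map_zero, smul_zero]
        · have := ih1 (j - k) (by omega)
          rw [show 2 * (j - k) + f = a by omega, show ℓ - (j - k) = ℓ - j + k by omega] at this
          rw [this, smul_zero]
      · rw [(hs.apply_mem hM t (ℓ - j) b (by omega)).1 h, map_zero]
    constructor
    · intro j hj
      have hodd : Odd (2 * j + f) := Nat.odd_iff.2 (by omega)
      rw [hM.succ_apply, sum_eq_add (0, 2 * j + f) (2 * j + f, 0) (by simp; omega)]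
      · simp [hM.zero, hodd.neg_one_pow]
      · rintro ⟨a, b⟩ hm ⟨h1, h2⟩
        rw [HasAntidiagonal.mem_antidiagonal] at hm
        simp only at hm ⊢
        have ha : a ≠ 0 := by rintro rfl; apply h1; ext <;> simp_all
        have hb : b ≠ 0 := by rintro rfl; apply h2; ext <;> simp_all
        rw [key j (by omega) a b hm ha hb (by omega), smul_zero]
      · simp
      · simp
    · have hodd : Odd (2 * (t + 1) + f) := Nat.odd_iff.2 (by omega)
      have hodd' : Odd (2 * t + f) := Nat.odd_iff.2 (by omega)
      refine ⟨-((2 * (t + 1) + f).choose (2 * t + f) : ℤ) * 2 ^ t * c, ?_, ?_⟩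
      · have : (2 * (t + 1) + f).choose (2 * t + f) ≠ 0 := (Nat.choose_pos (by omega)).ne'
        simp [this, hc0]
      · rw [hM.succ_apply, ← sum_subset (s₁ := {(0, 2 * (t + 1) + f), (2 * (t + 1) + f, 0),
          (2 * t + f, 2)})]
        · rw [sum_insert (by simp; omega), sum_insert (by simp), sum_singleton]
          simp only [hM.zero, hs.apply_two hM t (ℓ - (t + 1)) (by omega)]
          rw [show ℓ - (t + 1) + 1 = ℓ - t by omega, map_zsmul, hc, hodd.neg_one_pow,
            hodd'.neg_one_pow]
          simp [mul_smul]
        · intro m hm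
          simp only [mem_insert, mem_singleton] at hm
          rw [HasAntidiagonal.mem_antidiagonal]
          rcases hm with rfl | rfl | rfl <;> simp
          ring
        · rintro ⟨a, b⟩ hm hm'
          rw [HasAntidiagonal.mem_antidiagonal] at hm
          simp only [mem_insert, mem_singleton, Prod.mk.injEq, not_or] at hm hm' ⊢
          rw [key (t + 1) le_rfl a b hm (by omega) (by omega) (by omega), smul_zero]

end MomentSeqAction

/-! ### Sequences all of whose iterated differences are typical -/

/-- The concatenation of two `2 ^ ℓ`-tuples. -/
def joinTuple {ι : Type*} {ℓ : ℕ} (x y : Fin (2 ^ ℓ) → ι) (i : Fin (2 ^ (ℓ + 1))) : ι :=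
  if h : i.val < 2 ^ ℓ then x ⟨i, h⟩
  else y ⟨i - 2 ^ ℓ, by have := i.isLt; have := pow_succ 2 ℓ; omega⟩

theorem iterDiff_joinTuple {ι : Type*} (n : ι → ℤ) {ℓ : ℕ} (x y : Fin (2 ^ ℓ) → ι) :
    iterDiff (ℓ + 1) (fun i => n (joinTuple x y i)) =
      iterDiff ℓ (fun i => n (y i)) - iterDiff ℓ (fun i => n (x i)) := by
  simp [iterDiff, joinTuple]

theorem strictMono_joinTuple {ι : Type*} [Preorder ι] {ℓ : ℕ} {x y : Fin (2 ^ ℓ) → ι}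
    (hx : StrictMono x) (hy : StrictMono y) (hxy : ∀ i j, x i < y j) :
    StrictMono (joinTuple x y) := by
  intro i j hij
  rw [Fin.lt_def] at hij
  unfold joinTuple
  split_ifs
  · exact hx (by simpa using hij)
  · exact hxy _ _
  · omega
  · exact hy (by rw [Fin.lt_def]; simp; omega)

/-- Along a sequence of integer-valued functions, the typical elements of the iterated difference
law are iterated differences of arbitrarily late terms. -/
theorem eventually_diffLaw_exists {R : Type*} (n : ℕ → R → ℤ) (ℓ N : ℕ) :
    ∀ᶠ a in (diffLaw ℓ ((hyperfilter ℕ).map n) : Filter (R → ℤ)),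
      ∃ j : Fin (2 ^ ℓ) → ℕ, StrictMono j ∧ (∀ i, N < j i) ∧
        a = fun r => iterDiff ℓ fun i => n (j i) r := by
  induction ℓ generalizing N with
  | zero =>
    change ∀ᶠ k in (hyperfilter ℕ : Filter ℕ), _
    filter_upwards [Nat.hyperfilter_le_atTop (eventually_gt_atTop N)] with k hk
    exact ⟨fun _ => k, fun a b hab => by omega, fun _ => hk, rfl⟩
  | succ ℓ ih =>
    rw [eventually_diffLaw_succ]
    filter_upwards [ih N] with a ha
    obtain ⟨x, hx, hxN, rfl⟩ := ha
    filter_upwards [ih (N + ∑ i, x i)] with b hb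
    obtain ⟨y, hy, hyN, rfl⟩ := hb
    refine ⟨joinTuple x y, strictMono_joinTuple hx hy fun i k => ?_, fun i => ?_, ?_⟩
    · have h1 := hyN k
      have h2 : x i ≤ ∑ i, x i := single_le_sum (fun _ _ => Nat.zero_le _) (mem_univ i)
      omega
    · unfold joinTuple
      split_ifs
      · exact hxN _
      · exact lt_of_le_of_lt (Nat.le_add_right _ _) (hyN _)
    · ext r
      exact (iterDiff_joinTuple (fun k => n k r) x y).symm

/-- Let `G` be a set of finite sequences that contains the empty one and is such that any member of
`G` extends by `u`-most integers. Then some infinite increasing sequence has all its finite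
subsequences in `G`. -/
theorem exists_strictMono_forall_mem {u : Ultrafilter ℤ} (hu : (u : Filter ℤ) ≤ atTop) {S : Set ℤ}
    (hS : S ∈ u) {G : Set (List ℤ)} (h0 : [] ∈ G)
    (hG : ∀ l ∈ G, ∀ᶠ k in (u : Filter ℤ), l ++ [k] ∈ G) :
    ∃ φ : ℕ → ℤ, StrictMono φ ∧ (∀ k, φ k ∈ S) ∧
      ∀ l : List ℕ, l.Pairwise (· < ·) → l.map φ ∈ G := by
  have step : ∀ L : {L : List ℤ // ∀ s, s.Sublist L → s ∈ G}, ∃ k ∈ S, (∀ x ∈ L.1, x < k) ∧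
      ∀ s, s.Sublist (L.1 ++ [k]) → s ∈ G := by
    rintro ⟨L, hL⟩
    have h1 : ∀ᶠ k in (u : Filter ℤ), ∀ x ∈ L.toFinset, x < k :=
      (eventually_all_finset _).2 fun x _ => hu (eventually_gt_atTop x)
    have h2 : ∀ᶠ k in (u : Filter ℤ), ∀ s ∈ L.sublists.toFinset, s ++ [k] ∈ G :=
      (eventually_all_finset _).2 fun s hs => hG s (hL s (by simpa using hs))
    obtain ⟨k, hk, hkL, hkG⟩ := ((show ∀ᶠ k in (u : Filter ℤ), k ∈ S from hS).and
      (h1.and h2)).exists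
    refine ⟨k, hk, fun x hx => hkL x (by simpa using hx), fun s hs => ?_⟩
    obtain ⟨s₁, s₂, rfl, hs₁, hs₂⟩ := List.sublist_append_iff.1 hs
    rcases List.sublist_singleton.1 hs₂ with rfl | rfl
    · simpa using hL s₁ hs₁
    · exact hkG s₁ (by simpa using hs₁)
  choose next hnS hnlt hnG using step
  obtain ⟨F, hF0, hFs⟩ : ∃ F : ℕ → {L : List ℤ // ∀ s, s.Sublist L → s ∈ G}, (F 0).1 = [] ∧
      ∀ m, (F (m + 1)).1 = (F m).1 ++ [next (F m)] :=
    ⟨fun m => Nat.rec ⟨[], fun s hs => by rwa [List.sublist_nil.1 hs]⟩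
      (fun _ L => ⟨L.1 ++ [next L], hnG L⟩) m, rfl, fun _ => rfl⟩
  obtain ⟨φ, hφ⟩ : ∃ φ : ℕ → ℤ, ∀ m, φ m = next (F m) := ⟨_, fun _ => rfl⟩
  have hF : ∀ m, (F m).1 = (List.range m).map φ := by
    intro m
    induction m with
    | zero => simp [hF0]
    | succ m ih => rw [hFs, List.range_succ, List.map_append, ← ih, List.map_singleton, hφ]
  refine ⟨φ, strictMono_nat_of_lt_succ fun m => ?_, fun k => hφ k ▸ hnS _, fun l hl => ?_⟩
  · rw [hφ (m + 1)]
    refine hnlt (F (m + 1)) _ ?_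
    rw [hF]
    exact List.mem_map.2 ⟨m, by simp, rfl⟩
  · have hsub : l.Sublist (List.range (l.sum + 1)) := by
      refine List.sublist_of_subperm_of_pairwise ?_ hl List.pairwise_lt_range
      refine List.Nodup.subperm (hl.imp fun h => h.ne) fun x hx => ?_
      rw [List.mem_range]
      exact Nat.lt_succ_of_le (List.single_le_sum (fun _ _ => Nat.zero_le _) x hx)
    refine (F (l.sum + 1)).2 _ ?_
    rw [hF]
    exact hsub.map φ

/-- A property that holds for typical iterated differences is witnessed by a set of finite sequences
with the extension property of `exists_strictMono_forall_mem`. -/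
theorem exists_extension_set {u : Ultrafilter ℤ} (ℓ : ℕ) {P : ℤ → Prop}
    (hP : ∀ᶠ a in (diffLaw ℓ u : Filter ℤ), P a) :
    ∃ G : Set (List ℤ), [] ∈ G ∧ (∀ l ∈ G, ∀ᶠ k in (u : Filter ℤ), l ++ [k] ∈ G) ∧
      ∀ l ∈ G, l.length = 2 ^ ℓ → P (iterDiff ℓ fun i => l.getD i 0) := by
  induction ℓ generalizing P with
  | zero =>
    refine ⟨{l | l.length = 1 → P (l.getD 0 0)}, by simp, ?_, fun l hl h => hl h⟩
    intro l _
    have hP' : ∀ᶠ a in (u : Filter ℤ), P a := hP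
    filter_upwards [hP'] with k hk h
    have : l = [] := by simpa using h
    simpa [this] using hk
  | succ ℓ ih =>
    rw [eventually_diffLaw_succ] at hP
    obtain ⟨G, hG0, hG1, hG2⟩ := ih hP
    have H : ∀ x, ∃ H : Set (List ℤ), (∀ᶠ y in (diffLaw ℓ u : Filter ℤ), P (y - x)) →
        [] ∈ H ∧ (∀ l ∈ H, ∀ᶠ k in (u : Filter ℤ), l ++ [k] ∈ H) ∧
          ∀ l ∈ H, l.length = 2 ^ ℓ → P ((iterDiff ℓ fun i => l.getD i 0) - x) := by
      intro x
      by_cases hx : ∀ᶠ y in (diffLaw ℓ u : Filter ℤ), P (y - x)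
      · obtain ⟨H, hH⟩ := ih (P := fun y => P (y - x)) hx
        exact ⟨H, fun _ => hH⟩
      · exact ⟨∅, fun h => absurd h hx⟩
    choose H hH using H
    refine ⟨{l | l.take (2 ^ ℓ) ∈ G ∧ (2 ^ ℓ ≤ l.length →
      l.drop (2 ^ ℓ) ∈ H (iterDiff ℓ fun i => (l.take (2 ^ ℓ)).getD i 0))}, ?_, ?_, ?_⟩
    · simpa using hG0
    · rintro l ⟨h1, h2⟩
      rcases lt_or_ge l.length (2 ^ ℓ) with hl | hl
      · rw [List.take_of_length_le hl.le] at h1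
        filter_upwards [hG1 l h1] with k hk
        have hlen : (l ++ [k]).length ≤ 2 ^ ℓ := by simpa using hl
        refine ⟨by rwa [List.take_of_length_le hlen], fun h => ?_⟩
        rw [List.take_of_length_le hlen, List.drop_of_length_le hlen]
        exact (hH _ (hG2 _ hk (le_antisymm hlen h))).1
      · have hlen : (l.take (2 ^ ℓ)).length = 2 ^ ℓ := by simpa using hl
        filter_upwards [(hH _ (hG2 _ h1 hlen)).2.1 _ (h2 hl)] with k hk
        rw [List.take_append_of_le_length hl, List.drop_append_of_le_length hl]
        exact ⟨h1, fun _ => hk⟩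
    · rintro l ⟨h1, h2⟩ hl
      rw [pow_succ] at hl
      have hlen : (l.take (2 ^ ℓ)).length = 2 ^ ℓ := by simp; omega
      have h3 := (hH _ (hG2 _ h1 hlen)).2.2 _ (h2 (by omega)) (by simp; omega)
      convert h3 using 2
      rw [iterDiff]
      congr 2
      · ext i
        simp [List.getD_eq_getElem?_getD]
      · ext i
        simp [List.getD_eq_getElem?_getD]

/-- A property of typical iterated differences holds for all iterated differences of a suitable
increasing sequence, taken in any prescribed set of the ultrafilter. -/
theorem exists_strictMono_forall_iterDiff {u : Ultrafilter ℤ} (hu : (u : Filter ℤ) ≤ atTop)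
    {S : Set ℤ} (hS : S ∈ u) {ℓ : ℕ} {P : ℤ → Prop}
    (hP : ∀ᶠ a in (diffLaw ℓ u : Filter ℤ), P a) :
    ∃ φ : ℕ → ℤ, StrictMono φ ∧ (∀ k, φ k ∈ S) ∧
      ∀ j : Fin (2 ^ ℓ) → ℕ, StrictMono j → P (iterDiff ℓ fun i => φ (j i)) := by
  obtain ⟨G, h0, h1, h2⟩ := exists_extension_set ℓ hP
  obtain ⟨φ, hφ, hφS, hφG⟩ := exists_strictMono_forall_mem hu hS h0 h1
  refine ⟨φ, hφ, hφS, fun j hj => ?_⟩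
  have h := h2 _ (hφG (List.ofFn j) (List.pairwise_ofFn.2 fun _ _ h => hj h)) (by simp)
  convert h using 2
  ext i
  simp [List.getD_eq_getElem?_getD]

open MeasureTheory AddCircle UnitAddTorus
open scoped ComplexConjugate

/-! ### Means of bounded sequences along an ultrafilter -/

/-- `L` is the limit of the Cesàro averages of `u` along a fixed nonprincipal ultrafilter. Every
bounded sequence has such a mean, and it is invariant under shifts. -/
def HasMean (u : ℕ → ℂ) (L : ℂ) : Prop :=
  Tendsto (fun N : ℕ => (N : ℂ)⁻¹ * ∑ n ∈ range N, u n) (hyperfilter ℕ) (𝓝 L)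

theorem norm_average_le {u : ℕ → ℂ} {C : ℝ} (hu : ∀ n, ‖u n‖ ≤ C) (N : ℕ) :
    ‖(N : ℂ)⁻¹ * ∑ n ∈ range N, u n‖ ≤ C := by
  have hC : 0 ≤ C := (norm_nonneg _).trans (hu 0)
  rcases Nat.eq_zero_or_pos N with rfl | hN
  · simpa using hC
  have hN' : (0 : ℝ) < N := Nat.cast_pos.2 hN
  rw [norm_mul, norm_inv, Complex.norm_natCast, inv_mul_le_iff₀ hN']
  refine (norm_sum_le _ _).trans ((sum_le_sum fun n _ => hu n).trans ?_)
  simp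

theorem exists_hasMean {u : ℕ → ℂ} {C : ℝ} (hu : ∀ n, ‖u n‖ ≤ C) : ∃ L, HasMean u L := by
  obtain ⟨L, -, hL⟩ := (isCompact_closedBall (0 : ℂ) C).ultrafilter_le_nhds
    ((hyperfilter ℕ).map fun N : ℕ => (N : ℂ)⁻¹ * ∑ n ∈ range N, u n)
    (le_principal_iff.2 (show ∀ᶠ N : ℕ in (hyperfilter ℕ : Filter ℕ),
      (N : ℂ)⁻¹ * ∑ n ∈ range N, u n ∈ Metric.closedBall 0 C from
        Eventually.of_forall fun N => by simpa using norm_average_le hu N))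
  exact ⟨L, hL⟩

namespace HasMean

variable {u v : ℕ → ℂ} {L K : ℂ}

theorem unique (h : HasMean u L) (h' : HasMean u K) : L = K :=
  tendsto_nhds_unique h h'

theorem norm_le {C : ℝ} (hu : ∀ n, ‖u n‖ ≤ C) (h : HasMean u L) : ‖L‖ ≤ C :=
  le_of_tendsto h.norm (Eventually.of_forall fun N => norm_average_le hu N)

theorem sum {κ : Type*} {s : Finset κ} {w : κ → ℕ → ℂ} {c : κ → ℂ}
    (h : ∀ i ∈ s, HasMean (w i) (c i)) : HasMean (fun n => ∑ i ∈ s, w i n) (∑ i ∈ s, c i) := by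
  refine (tendsto_finsetSum s h).congr fun N => ?_
  rw [← mul_sum, sum_comm]

theorem add (h : HasMean u L) (h' : HasMean v K) : HasMean (fun n => u n + v n) (L + K) := by
  refine (Tendsto.add h h').congr fun N => ?_
  rw [← mul_add, ← sum_add_distrib]

theorem const_mul (c : ℂ) (h : HasMean u L) : HasMean (fun n => c * u n) (c * L) := by
  refine (Tendsto.const_mul c h).congr fun N => ?_
  rw [← mul_sum]
  ring

theorem conjugate (h : HasMean u L) : HasMean (fun n => conj (u n)) (conj L) := by
  refine ((Complex.continuous_conj.tendsto L).comp h).congr fun N => ?_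
  simp

theorem of_eventually_eq (h : ∀ᶠ n in atTop, u n = L) : HasMean u L :=
  (Filter.Tendsto.cesaro_smul (u := u) (l := L) (tendsto_nhds_of_eventually_eq h)).mono_left
    Nat.hyperfilter_le_atTop |>.congr fun N => by simp

theorem shift {C : ℝ} (hu : ∀ n, ‖u n‖ ≤ C) (h : HasMean u L) (k : ℕ) :
    HasMean (fun n => u (n + k)) L := by
  induction k with
  | zero => exact h
  | succ k ih =>
    have h0 : Tendsto (fun N : ℕ => (N : ℂ)⁻¹ * (u (N + k) - u k)) (hyperfilter ℕ) (𝓝 0) := by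
      refine Tendsto.mono_left ?_ Nat.hyperfilter_le_atTop
      refine Tendsto.zero_mul_isBoundedUnder_le tendsto_inv_atTop_nhds_zero_nat ?_
      refine isBoundedUnder_of ⟨C + C, fun N => ?_⟩
      exact (norm_sub_le _ _).trans (add_le_add (hu _) (hu _))
    have h1 := Tendsto.add ih h0
    rw [add_zero] at h1
    refine h1.congr fun N => ?_
    have h2 := (sum_range_succ (fun n => u (n + k)) N).symm.trans
      (sum_range_succ' (fun n => u (n + k)) N)
    simp only [zero_add] at h2
    rw [← mul_add, ← add_sub_assoc, h2]
    simp [add_assoc, add_comm 1]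

theorem norm_sq_le {b : ℝ} (h : HasMean u L) (h' : HasMean (fun n => ((‖u n‖ ^ 2 : ℝ) : ℂ)) b) :
    ‖L‖ ^ 2 ≤ b := by
  have h1 := (Complex.continuous_re.tendsto _).comp h'
  refine le_of_tendsto_of_tendsto (h.norm.pow 2) h1 (Eventually.of_forall fun N => ?_)
  have h2 : ((N : ℂ)⁻¹ * ∑ n ∈ range N, ((‖u n‖ ^ 2 : ℝ) : ℂ)).re =
      (N : ℝ)⁻¹ * ∑ n ∈ range N, ‖u n‖ ^ 2 := by
    rw [← Complex.ofReal_sum, ← Complex.ofReal_natCast, ← Complex.ofReal_inv, ← Complex.ofReal_mul,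
      Complex.ofReal_re]
  change ‖(N : ℂ)⁻¹ * ∑ n ∈ range N, u n‖ ^ 2 ≤
    ((N : ℂ)⁻¹ * ∑ n ∈ range N, ((‖u n‖ ^ 2 : ℝ) : ℂ)).re
  rw [h2]
  rcases Nat.eq_zero_or_pos N with rfl | hN
  · simp
  have hN' : (0 : ℝ) < N := Nat.cast_pos.2 hN
  have h3 : ‖∑ n ∈ range N, u n‖ ^ 2 ≤ N * ∑ n ∈ range N, ‖u n‖ ^ 2 := by
    refine (pow_le_pow_left₀ (norm_nonneg _) (norm_sum_le _ _) 2).trans ?_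
    simpa using sq_sum_le_card_mul_sum_sq (s := range N) (f := fun n => ‖u n‖)
  rw [norm_mul, norm_inv, Complex.norm_natCast, mul_pow, inv_pow, inv_mul_le_iff₀ (by positivity)]
  refine h3.trans_eq ?_
  field_simp

/-- Van der Corput's lemma. The average of `H` shifts of `u` has the same mean `L`, and the mean of
its square is `1 / H`, because distinct shifts are uncorrelated. -/
theorem zero_of_correlations (hu : ∀ n, ‖u n‖ = 1)
    (h : ∀ k, 0 < k → HasMean (fun n => u (n + k) * conj (u n)) 0) : HasMean u 0 := by
  obtain ⟨L, hL⟩ := exists_hasMean fun n => (hu n).le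
  have hcor : ∀ i j, HasMean (fun n => u (n + i) * conj (u (n + j))) (if i = j then 1 else 0) := by
    have hlt : ∀ i j, j < i → HasMean (fun n => u (n + i) * conj (u (n + j))) 0 := by
      intro i j hij
      have := (h (i - j) (by omega)).shift (C := 1) (fun n => by simp [hu]) j
      refine Eq.subst (motive := fun w => HasMean w 0) ?_ this
      ext n
      rw [show n + j + (i - j) = n + i by omega]
    intro i j
    rcases lt_trichotomy i j with hij | rfl | hij
    · rw [if_neg hij.ne]
      simpa [mul_comm] using (hlt j i hij).conjugate
    · rw [if_pos rfl]
      refine of_eventually_eq (Eventually.of_forall fun n => ?_)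
      simp [Complex.mul_conj, Complex.normSq_eq_norm_sq, hu]
    · rw [if_neg hij.ne']
      exact hlt i j hij
  have hH : ∀ H : ℕ, (H * ‖L‖) ^ 2 ≤ H := by
    intro H
    have h1 : HasMean (fun n => ∑ i ∈ range H, u (n + i)) (∑ i ∈ range H, L) :=
      HasMean.sum fun i _ => hL.shift (fun n => (hu n).le) i
    have h2 : HasMean (fun n => ∑ i ∈ range H, ∑ j ∈ range H, u (n + i) * conj (u (n + j)))
        (∑ i ∈ range H, ∑ j ∈ range H, if i = j then 1 else 0) :=
      HasMean.sum fun i _ => HasMean.sum fun j _ => hcor i j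
    have h3 := h1.norm_sq_le (b := H) ?_
    · simpa using h3
    · convert h2 using 1
      · ext n
        rw [← Complex.normSq_eq_norm_sq, ← Complex.mul_conj, map_sum, sum_mul_sum]
      · rw [sum_congr rfl fun i hi => by rw [sum_ite_eq, if_pos hi]]
        simp
  have hL0 : ‖L‖ = 0 := by
    by_contra hne
    have hpos : 0 < ‖L‖ ^ 2 := by positivity
    obtain ⟨H, hH'⟩ := exists_nat_gt (1 / ‖L‖ ^ 2)
    have hHpos : (0 : ℝ) < H := lt_trans (by positivity) hH'
    have h1 := hH H
    rw [div_lt_iff₀ hpos] at hH'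
    nlinarith
  rwa [norm_eq_zero.1 hL0] at hL

end HasMean

/-! ### Weyl's theorem on polynomial sequences -/

/-- Weyl's theorem for polynomials whose leading coefficient is irrational. -/
theorem hasMean_toCircle_eval (k : ℕ) (P : ℝ[X]) (hdeg : P.natDegree ≤ k + 1)
    (hirr : Irrational (P.coeff (k + 1))) :
    HasMean (fun n : ℕ => (toCircle ((P.eval (n : ℝ) : ℝ) : UnitAddCircle) : ℂ)) 0 := by
  have hnorm : ∀ n : ℕ, ‖(toCircle ((P.eval (n : ℝ) : ℝ) : UnitAddCircle) : ℂ)‖ = 1 :=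
    fun n => Circle.norm_coe _
  induction k generalizing P with
  | zero =>
    obtain ⟨L, hL⟩ := exists_hasMean fun n => (hnorm n).le
    have hP := P.eq_X_add_C_of_natDegree_le_one hdeg
    set z : ℂ := (toCircle ((P.coeff 1 : ℝ) : UnitAddCircle) : ℂ) with hz
    have hz1 : z ≠ 1 := by
      intro h
      have h0 : ((P.coeff 1 : ℝ) : UnitAddCircle) = 0 := by
        refine injective_toCircle one_ne_zero (Circle.ext ?_)
        rw [← hz, h, toCircle_zero, Circle.coe_one]
      obtain ⟨m, hm⟩ := (AddCircle.coe_eq_zero_iff 1).1 h0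
      exact hirr ⟨m, by simpa using hm⟩
    have h1 := hL.shift (fun n => (hnorm n).le) 1
    have h2 := hL.const_mul z
    have h3 : L = z * L := by
      refine h1.unique (Eq.subst (motive := fun w => HasMean w (z * L)) ?_ h2)
      ext n
      rw [hz, ← Circle.coe_mul, ← toCircle_add, ← AddCircle.coe_add]
      congr 3
      rw [hP]
      simp
      ring
    have h4 : L = 0 := by
      have : (z - 1) * L = 0 := by linear_combination -h3
      exact (mul_eq_zero.1 this).resolve_left (sub_ne_zero.2 hz1)
    rwa [h4] at hL
  | succ k ih =>
    refine HasMean.zero_of_correlations hnorm fun h hh => ?_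
    have hlead : (taylor (h : ℝ) P).coeff (k + 2) = P.coeff (k + 2) := by
      rw [taylor_coeff]
      have h1 : (hasseDeriv (k + 2) P).natDegree ≤ 0 :=
        (natDegree_hasseDeriv_le _ _).trans (by omega)
      rw [eq_C_of_natDegree_le_zero h1, eval_C, hasseDeriv_coeff]
      simp
    have hnext : (taylor (h : ℝ) P).coeff (k + 1) =
        P.coeff (k + 1) + ((k + 2) * h : ℕ) * P.coeff (k + 2) := by
      rw [taylor_coeff]
      have h1 : (hasseDeriv (k + 1) P).natDegree ≤ 1 :=
        (natDegree_hasseDeriv_le _ _).trans (by omega)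
      rw [eq_X_add_C_of_natDegree_le_one h1, hasseDeriv_coeff, hasseDeriv_coeff]
      simp [add_comm 1]
      ring
    have h2 := ih (taylor (h : ℝ) P - P) ?_ ?_ ?_
    · refine Eq.subst (motive := fun w => HasMean w 0) ?_ h2
      ext n
      rw [eval_sub, taylor_eval, sub_eq_add_neg, AddCircle.coe_add, toCircle_add, AddCircle.coe_neg,
        toCircle_neg, Circle.coe_mul, Circle.coe_inv_eq_conj]
      push_cast
      rfl
    · rw [natDegree_le_iff_coeff_eq_zero]
      intro m hm
      rw [coeff_sub]
      rcases eq_or_lt_of_le (show k + 2 ≤ m by omega) with rfl | hm'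
      · rw [hlead, sub_self]
      · rw [coeff_eq_zero_of_natDegree_lt (by rw [natDegree_taylor]; omega),
          coeff_eq_zero_of_natDegree_lt (by omega), sub_zero]
    · rw [coeff_sub, hnext, add_sub_cancel_left]
      exact hirr.natCast_mul (by positivity)
    · exact fun n => Circle.norm_coe _

/-! ### Equidistribution and recurrence on tori -/

theorem integral_mFourier {ι : Type*} [Fintype ι] {k : ι → ℤ} (hk : k ≠ 0) :
    ∫ x, mFourier k x ∂(Measure.pi fun _ : ι => (haarAddCircle : Measure UnitAddCircle)) = 0 := by
  obtain ⟨i, hi⟩ := Function.ne_iff.1 hk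
  change ∫ x : ι → UnitAddCircle, ∏ i, fourier (k i) (x i) ∂_ = 0
  rw [integral_fintype_prod_eq_prod (fun i x => (fourier (k i) x : ℂ))]
  exact prod_eq_zero (mem_univ i) (integral_eq_zero_of_add_right_eq_neg
    (fourier_add_half_inv_index hi one_pos))

/-- A sequence in a torus along which all nontrivial characters have mean zero has the integral as
mean of every continuous function. -/
theorem hasMean_continuousMap {ι : Type*} [Fintype ι] {x : ℕ → UnitAddTorus ι}
    (hx : ∀ k : ι → ℤ, k ≠ 0 → HasMean (fun n => mFourier k (x n)) 0)
    (f : C(UnitAddTorus ι, ℂ)) :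
    HasMean (fun n => f (x n))
      (∫ t, f t ∂(Measure.pi fun _ : ι => (haarAddCircle : Measure UnitAddCircle))) := by
  set μ := Measure.pi fun _ : ι => (haarAddCircle : Measure UnitAddCircle)
  have hint : ∀ g : C(UnitAddTorus ι, ℂ), Integrable g μ := fun g =>
    g.continuous.integrable_of_hasCompactSupport (HasCompactSupport.of_compactSpace _)
  have hspan : ∀ g ∈ Submodule.span ℂ (Set.range (mFourier (d := ι))),
      HasMean (fun n => g (x n)) (∫ t, g t ∂μ) := by
    intro g hg
    induction hg using Submodule.span_induction with
    | mem g hg =>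
      obtain ⟨k, rfl⟩ := hg
      rcases eq_or_ne k 0 with rfl | hk
      · rw [mFourier_zero]
        refine HasMean.of_eventually_eq (Eventually.of_forall fun n => ?_)
        simp
      · rw [integral_mFourier hk]
        exact hx k hk
    | zero => exact HasMean.of_eventually_eq (Eventually.of_forall fun n => by simp)
    | add g h _ _ hg hh =>
      simp only [ContinuousMap.add_apply]
      rw [integral_add (hint g) (hint h)]
      exact hg.add hh
    | smul c g _ hg =>
      simp only [ContinuousMap.smul_apply, smul_eq_mul]
      rw [integral_const_mul]
      exact hg.const_mul c
  obtain ⟨L, hL⟩ := exists_hasMean fun n => f.norm_coe_le_norm (x n)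
  suffices h : L = ∫ t, f t ∂μ by rwa [← h]
  refine eq_of_forall_dist_le fun ε hε => ?_
  have hf : f ∈ closure (Submodule.span ℂ (Set.range (mFourier (d := ι))) : Set _) := by
    have h := (span_mFourier_closure_eq_top (d := ι)).ge (Submodule.mem_top (x := f))
    exact h
  obtain ⟨g, hg, hfg⟩ := Metric.mem_closure_iff.1 hf (ε / 2) (half_pos hε)
  rw [dist_eq_norm] at hfg
  have h1 : ‖L + (-1) * ∫ t, g t ∂μ‖ ≤ ε / 2 := by
    refine (hL.add ((hspan g hg).const_mul (-1))).norm_le fun n => ?_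
    rw [neg_one_mul, ← sub_eq_add_neg]
    exact ((f - g).norm_coe_le_norm (x n)).trans hfg.le
  have h2 : ‖∫ t, (f t - g t) ∂μ‖ ≤ ε / 2 := by
    refine (norm_integral_le_of_norm_le_const (C := ε / 2) (Eventually.of_forall fun t => ?_)).trans
      (by simp [μ])
    exact ((f - g).norm_coe_le_norm t).trans hfg.le
  rw [integral_sub (hint f) (hint g)] at h2
  rw [dist_eq_norm]
  calc ‖L - ∫ t, f t ∂μ‖
      = ‖(L + (-1) * ∫ t, g t ∂μ) - (∫ t, f t ∂μ - ∫ t, g t ∂μ)‖ := by congr 1; ring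
    _ ≤ ε := (norm_sub_le _ _).trans (by linarith)

/-- A sequence in a torus along which all nontrivial characters have mean zero accumulates at every
point. -/
theorem mapClusterPt_of_hasMean {ι : Type*} [Fintype ι] {x : ℕ → UnitAddTorus ι}
    (hx : ∀ k : ι → ℤ, k ≠ 0 → HasMean (fun n => mFourier k (x n)) 0) (θ : UnitAddTorus ι) :
    MapClusterPt θ atTop x := by
  rw [mapClusterPt_iff_frequently]
  intro s hs hnot
  obtain ⟨O, hOs, hO, hθ⟩ := mem_nhds_iff.1 hs
  obtain ⟨g, hg0, hg1, hg⟩ := exists_continuous_zero_one_of_isClosed hO.isClosed_compl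
    (isClosed_singleton (x := θ)) (by simpa using hθ)
  have h1 := hasMean_continuousMap hx ⟨fun t => ((g t : ℝ) : ℂ), by fun_prop⟩
  have h2 : HasMean (fun n => ((g (x n) : ℝ) : ℂ)) 0 := by
    refine HasMean.of_eventually_eq ?_
    filter_upwards [hnot] with n hn
    have : g (x n) = 0 := hg0 fun h => hn (hOs h)
    simp [this]
  have h3 := h1.unique h2
  simp only [ContinuousMap.coe_mk] at h3
  rw [integral_complex_ofReal, Complex.ofReal_eq_zero] at h3
  refine (g.continuous.integral_pos_of_hasCompactSupport_nonneg_nonzero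
    (HasCompactSupport.of_compactSpace _) (fun t => (hg t).1) (x := θ) ?_).ne' h3
  rw [hg1 rfl]
  exact one_ne_zero

theorem prod_coe_toCircle {κ : Type*} (s : Finset κ) (f : κ → UnitAddCircle) :
    ∏ p ∈ s, (toCircle (f p) : ℂ) = toCircle (∑ p ∈ s, f p) := by
  induction s using Finset.cons_induction with
  | empty => simp [toCircle_zero]
  | cons p s hp ih => rw [prod_cons, sum_cons, ih, toCircle_add, Circle.coe_mul]

/-- If no nontrivial integer combination of the `γ i` is rational, then the powers
`n ^ e * γ i` modulo `1` can be steered to arbitrary limits simultaneously, along some ultrafilter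
of large integers. -/
theorem exists_ultrafilter_tendsto {m : ℕ} (d : ℕ) {γ : Fin m → ℝ}
    (hγ : ∀ k : Fin m → ℤ, k ≠ 0 → Irrational (∑ i, k i * γ i))
    (θ : Fin m → ℕ → UnitAddCircle) :
    ∃ u : Ultrafilter ℤ, (u : Filter ℤ) ≤ atTop ∧ ∀ i e, e ≠ 0 → e ≤ d →
      Tendsto (fun a : ℤ => a ^ e • (γ i : UnitAddCircle)) u (𝓝 (θ i e)) := by
  let x : ℕ → UnitAddTorus (Fin m × Fin d) :=
    fun n p => ((n : ℤ) ^ (p.2.val + 1)) • (γ p.1 : UnitAddCircle)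
  have hx : ∀ k : Fin m × Fin d → ℤ, k ≠ 0 → HasMean (fun n => mFourier k (x n)) 0 := by
    intro k hk
    obtain ⟨p₀, hp₀⟩ := Function.ne_iff.1 hk
    -- the highest power of `n` that occurs in the character
    obtain ⟨⟨i₁, e⟩, hp₁, hmax⟩ := exists_max_image (univ.filter fun p => k p ≠ 0) (fun p => p.2)
      ⟨p₀, by simpa using hp₀⟩
    simp only [mem_filter, mem_univ, true_and] at hp₁ hmax
    let P : ℝ[X] := ∑ p, C (k p * γ p.1) * X ^ (p.2.val + 1)
    have hcoeff : P.coeff (e.val + 1) = ∑ i, k (i, e) * γ i := by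
      simp only [P, finsetSum_coeff, coeff_C_mul, coeff_X_pow]
      rw [Fintype.sum_prod_type]
      refine sum_congr rfl fun i _ => ?_
      rw [sum_eq_single e]
      · simp
      · intro b _ hb
        rw [if_neg (by rw [Nat.add_right_cancel_iff]; exact fun h => hb (Fin.ext h.symm)), mul_zero]
      · simp
    have hdeg : P.natDegree ≤ e.val + 1 := by
      refine natDegree_sum_le_of_forall_le _ _ fun p _ => ?_
      by_cases hp : k p = 0
      · simp [hp]
      · refine (natDegree_C_mul_X_pow_le _ _).trans ?_
        have := hmax p hp
        rw [Fin.le_def] at this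
        omega
    have hirr : Irrational (P.coeff (e.val + 1)) := by
      rw [hcoeff]
      exact hγ (fun i => k (i, e)) fun h => hp₁ (congrFun h i₁)
    refine Eq.subst (motive := fun w => HasMean w 0) ?_ (hasMean_toCircle_eval e P hdeg hirr)
    ext n
    change _ = ∏ p, fourier (k p) (x n p)
    simp only [fourier_apply]
    rw [prod_coe_toCircle]
    congr 2
    simp only [P, x, eval_finsetSum, eval_mul, eval_C, eval_pow, eval_X]
    rw [← QuotientAddGroup.mk'_apply, map_sum]
    refine sum_congr rfl fun p _ => ?_
    rw [QuotientAddGroup.mk'_apply, ← AddCircle.coe_zsmul, ← AddCircle.coe_zsmul]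
    congr 1
    simp only [zsmul_eq_mul]
    push_cast
    ring
  obtain ⟨U, hU, hUx⟩ := mapClusterPt_iff_ultrafilter.1
    (mapClusterPt_of_hasMean hx fun p => θ p.1 (p.2.val + 1))
  refine ⟨U.map Nat.cast, ?_, fun i e he hed => ?_⟩
  · rw [Ultrafilter.coe_map]
    exact (tendsto_natCast_atTop_atTop (R := ℤ)).mono_left hU
  · have := (tendsto_pi_nhds.1 hUx) (i, ⟨e - 1, by omega⟩)
    simp only [x, Nat.sub_add_cancel (Nat.one_le_iff_ne_zero.2 he)] at this
    exact this

theorem exists_linearIndependent_extension {α : ℝ} (hα : Irrational α) (m : ℕ) :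
    ∃ β : Fin (m + 2) → ℝ, LinearIndependent ℚ β ∧ β 0 = 1 ∧ β 1 = α := by
  induction m with
  | zero =>
    refine ⟨![1, α], ?_, rfl, rfl⟩
    rw [LinearIndependent.pair_iff]
    intro s t h
    rw [Rat.smul_def, Rat.smul_def, mul_one] at h
    have ht : t = 0 := by
      by_contra ht
      refine hα ⟨-s / t, ?_⟩
      have : (t : ℝ) ≠ 0 := by exact_mod_cast ht
      push_cast
      field_simp
      linarith
    subst ht
    simpa using h
  | succ m ih =>
    obtain ⟨β, hβ, h0, h1⟩ := ih
    obtain ⟨y, hy⟩ := exists_linearIndependent_snoc_of_lt_rank hβ (by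
      rw [Real.rank_rat_real]
      exact_mod_cast Cardinal.nat_lt_continuum (m + 2))
    refine ⟨Fin.snoc β y, hy, ?_, ?_⟩
    · rw [← h0]; exact Fin.snoc_castSucc (α := fun _ => ℝ) y β 0
    · rw [← h1]; exact Fin.snoc_castSucc (α := fun _ => ℝ) y β 1

theorem exists_irrational_combinations {α : ℝ} (hα : Irrational α) (m : ℕ) :
    ∃ γ : Fin (m + 1) → ℝ, γ 0 = α ∧
      ∀ k : Fin (m + 1) → ℤ, k ≠ 0 → Irrational (∑ i, k i * γ i) := by
  obtain ⟨β, hβ, h0, h1⟩ := exists_linearIndependent_extension hα m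
  refine ⟨fun i => β i.succ, h1, fun k hk => ?_⟩
  rintro ⟨q, hq⟩
  refine hk (funext fun i => ?_)
  have h := Fintype.linearIndependent_iff.1 hβ (Fin.cons (-q) fun i => (k i : ℚ)) (by
    rw [Fin.sum_univ_succ]
    simp only [Fin.cons_zero, Fin.cons_succ, Rat.smul_def, h0]
    push_cast
    linarith) i.succ
  simpa using h

/-! ### Polynomials that vanish modulo one along iterated differences -/

/-- The real polynomials whose values modulo `1` tend to `0` along `F`. -/
def nullPolys (F : Filter ℤ) : AddSubgroup ℝ[X] where
  carrier := {v | Tendsto (fun a : ℤ => ((v.eval (a : ℝ) : ℝ) : UnitAddCircle)) F (𝓝 0)}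
  zero_mem' := by simpa using tendsto_const_nhds
  add_mem' {v w} hv hw := by simpa using Tendsto.add hv hw
  neg_mem' {v} hv := by simpa using Tendsto.neg hv

theorem mem_nullPolys {F : Filter ℤ} {v : ℝ[X]} : v ∈ nullPolys F ↔
    Tendsto (fun a : ℤ => ((v.eval (a : ℝ) : ℝ) : UnitAddCircle)) F (𝓝 0) :=
  Iff.rfl

theorem distNearestInt_eq_norm (x : ℝ) : distNearestInt x = ‖(x : UnitAddCircle)‖ :=
  UnitAddCircle.norm_eq.symm

theorem mem_nullPolys_iff_distNearestInt {F : Filter ℤ} {v : ℝ[X]} : v ∈ nullPolys F ↔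
    ∀ ε > 0, ∀ᶠ a : ℤ in F, distNearestInt (v.eval (a : ℝ)) < ε := by
  rw [mem_nullPolys, Metric.tendsto_nhds]
  simp only [dist_zero_right, distNearestInt_eq_norm]

theorem coe_eval_C_mul_X_pow (α : ℝ) (d : ℕ) (a : ℤ) :
    (((C α * X ^ d : ℝ[X]).eval (a : ℝ) : ℝ) : UnitAddCircle) = a ^ d • (α : UnitAddCircle) := by
  rw [← AddCircle.coe_zsmul, eval_mul, eval_C, eval_pow, eval_X, zsmul_eq_mul, mul_comm]
  push_cast
  rfl

theorem isOddPoly_iff {p : ℝ[X]} : IsOddPoly p ↔ ∀ i, Even i → p.coeff i = 0 := by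
  rw [IsOddPoly, Polynomial.ext_iff]
  refine forall_congr' fun i => ?_
  rw [show (-X : ℝ[X]) = C (-1) * X by simp, comp_C_mul_X_coeff, coeff_neg]
  rcases Nat.even_or_odd i with h | h
  · simp [h, h.neg_one_pow, self_eq_neg]
  · simp [h.neg_one_pow, Nat.not_even_iff_odd.2 h]

theorem exists_denominator (w : ℚ[X]) :
    ∃ q : ℕ, 0 < q ∧ ∀ a : ℤ, ∃ m : ℤ, (q : ℚ) * w.eval (a : ℚ) = m := by
  induction w using Polynomial.induction_on' with
  | add f g hf hg =>
    obtain ⟨q, hq, hf⟩ := hf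
    obtain ⟨r, hr, hg⟩ := hg
    refine ⟨q * r, by positivity, fun a => ?_⟩
    obtain ⟨m, hm⟩ := hf a
    obtain ⟨n, hn⟩ := hg a
    refine ⟨r * m + q * n, ?_⟩
    push_cast
    rw [eval_add, ← hm, ← hn]
    ring
  | monomial n c =>
    refine ⟨c.den, c.pos, fun a => ⟨c.num * a ^ n, ?_⟩⟩
    rw [eval_monomial]
    push_cast
    rw [← Rat.den_mul_eq_num]
    ring

/-- If all odd monomials of degree at most `2 * ℓ - 1` vanish modulo `1` along `F`, then so does any
sum of an odd polynomial of degree at most `2 * ℓ - 1` and a rational polynomial with integral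
constant term: applied to `a / q`, the hypothesis says that the integers are eventually divisible
by `q` along `F`. -/
theorem mem_nullPolys_of_odd_add_rational {F : Filter ℤ} {ℓ : ℕ} (hℓ : 1 ≤ ℓ)
    (hF : ∀ (α : ℝ) (d : ℕ), Odd d → d + 1 ≤ 2 * ℓ → C α * X ^ d ∈ nullPolys F)
    {v : ℝ[X]} {w : ℚ[X]} {c : ℤ} (hc : w.eval 0 = (c : ℚ))
    (hodd : IsOddPoly (v - w.map (algebraMap ℚ ℝ)))
    (hdeg : (v - w.map (algebraMap ℚ ℝ)).natDegree ≤ 2 * ℓ - 1) : v ∈ nullPolys F := by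
  rw [← sub_add_cancel v (w.map (algebraMap ℚ ℝ))]
  refine add_mem ?_ ?_
  · rw [as_sum_support_C_mul_X_pow (v - w.map (algebraMap ℚ ℝ))]
    refine sum_mem fun i hi => hF _ _ ?_ ?_
    · rw [← Nat.not_even_iff_odd]
      exact fun h => mem_support_iff.1 hi (isOddPoly_iff.1 hodd i h)
    · have := le_natDegree_of_mem_supp i hi
      omega
  · obtain ⟨q, hq, hqw⟩ := exists_denominator w.divX
    have hq' : (0 : ℝ) < q := Nat.cast_pos.2 hq
    have h1 := mem_nullPolys_iff_distNearestInt.1 (hF (1 / q) 1 odd_one (by omega)) (1 / q)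
      (by positivity)
    rw [mem_nullPolys]
    refine tendsto_nhds_of_eventually_eq ?_
    filter_upwards [h1] with a ha
    obtain ⟨b, rfl⟩ : (q : ℤ) ∣ a := by
      refine ⟨round ((C (1 / q : ℝ) * X ^ 1 : ℝ[X]).eval (a : ℝ)), ?_⟩
      rw [distNearestInt] at ha
      set z := round ((C (1 / q : ℝ) * X ^ 1 : ℝ[X]).eval (a : ℝ))
      rw [← sub_eq_zero, ← Int.abs_lt_one_iff]
      have h2 : ((a - q * z : ℤ) : ℝ) = q * ((C (1 / q : ℝ) * X ^ 1 : ℝ[X]).eval (a : ℝ) - z) := by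
        simp
        field_simp
      have h3 : (|a - q * z| : ℝ) < 1 := by
        have h4 : |((a - q * z : ℤ) : ℝ)| < 1 := by
          rw [h2, abs_mul, abs_of_pos hq']
          calc (q : ℝ) * _ < q * (1 / q) := by gcongr
            _ = 1 := by field_simp
        simpa using h4
      exact_mod_cast h3
    obtain ⟨m, hm⟩ := hqw (q * b)
    have hval : w.eval ((q * b : ℤ) : ℚ) = ((m * b + c : ℤ) : ℚ) := by
      conv_lhs => rw [← divX_mul_X_add w]
      rw [coeff_zero_eq_eval_zero, hc, eval_add, eval_mul, eval_X, eval_C]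
      push_cast at hm ⊢
      linear_combination (b : ℚ) * hm
    have hval' : (w.map (algebraMap ℚ ℝ)).eval (((q * b : ℤ) : ℝ)) = ((m * b + c : ℤ) : ℝ) := by
      have := congrArg (algebraMap ℚ ℝ) hval
      rw [← eval_map_apply] at this
      simpa using this
    rw [hval']
    exact (AddCircle.coe_eq_zero_iff 1).2 ⟨m * b + c, by simp⟩

theorem tendsto_odd_pow_diffLaw {A : Type*} [CommRing A] {ℓ d : ℕ} (hd : Odd d)
    (hdl : d + 1 ≤ 2 * ℓ) (u : Ultrafilter A) (ψ : A →+ UnitAddCircle) :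
    Tendsto (fun a => ψ (a ^ d)) (diffLaw ℓ u) (𝓝 0) := by
  have h := tendsto_moment (diffLaw ℓ u) (fun a => a ^ d) ψ 1
  have h0 : (moment (diffLaw ℓ u) fun a : A => a ^ d) = (0 : AddMonoid.End (A →+ UnitAddCircle)) :=
    (isMomentSeq_diffMoment u).eq_zero_of_odd hd hdl
  rw [h0] at h
  simpa using h

/-- The polynomials whose values modulo `1` tend to `0` along all laws of `ℓ`-th iterated differences
of large integers. -/
noncomputable def nullDiffPolys (ℓ : ℕ) : AddSubgroup ℝ[X] :=
  ⨅ (u : Ultrafilter ℤ) (_ : (u : Filter ℤ) ≤ atTop), nullPolys (diffLaw ℓ u)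

theorem mem_nullDiffPolys {ℓ : ℕ} {v : ℝ[X]} : v ∈ nullDiffPolys ℓ ↔
    ∀ u : Ultrafilter ℤ, (u : Filter ℤ) ≤ atTop → v ∈ nullPolys (diffLaw ℓ u) := by
  simp [nullDiffPolys, AddSubgroup.mem_iInf]

theorem mem_nullDiffPolys_of_odd_add_rational {ℓ : ℕ} (hℓ : 1 ≤ ℓ) {v : ℝ[X]} {w : ℚ[X]} {c : ℤ}
    (hc : w.eval 0 = (c : ℚ)) (hodd : IsOddPoly (v - w.map (algebraMap ℚ ℝ)))
    (hdeg : (v - w.map (algebraMap ℚ ℝ)).natDegree ≤ 2 * ℓ - 1) : v ∈ nullDiffPolys ℓ := by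
  refine mem_nullDiffPolys.2 fun u _ => mem_nullPolys_of_odd_add_rational hℓ ?_ hc hodd hdeg
  intro α d hd hdl
  rw [mem_nullPolys]
  simp only [coe_eval_C_mul_X_pow]
  exact tendsto_odd_pow_diffLaw hd hdl u (zmultiplesHom UnitAddCircle (α : UnitAddCircle))

theorem comp_two_mul_X_mem {ℓ : ℕ} {v : ℝ[X]} (hv : v ∈ nullDiffPolys ℓ) :
    v.comp (C 2 * X) ∈ nullDiffPolys ℓ := by
  refine mem_nullDiffPolys.2 fun u hu => ?_
  have h := mem_nullDiffPolys.1 hv (u.map (AddMonoidHom.mulLeft (2 : ℤ))) (by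
    rw [Ultrafilter.coe_map]
    exact (tendsto_id.const_mul_atTop' (by norm_num : (0 : ℤ) < 2)).mono_left hu)
  rw [diffLaw_map, mem_nullPolys, Ultrafilter.coe_map, tendsto_map'_iff] at h
  refine h.congr fun a => ?_
  simp

/-- Combining `v (2 * x)` and `v` to cancel one coefficient at a time isolates a monomial. -/
theorem exists_monomial_mem {ℓ d : ℕ} {v : ℝ[X]} (hv : v ∈ nullDiffPolys ℓ)
    (hirr : Irrational (v.coeff d)) : ∃ α : ℝ, Irrational α ∧ C α * X ^ d ∈ nullDiffPolys ℓ := by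
  induction hN : v.support.card using Nat.strong_induction_on generalizing v with
  | _ N ih =>
    by_cases he : ∃ e ∈ v.support, e ≠ d
    · obtain ⟨e, he, hed⟩ := he
      have hcoeff : ∀ i, (v.comp (C 2 * X) - (2 ^ e : ℤ) • v).coeff i =
          ((2 ^ i - 2 ^ e : ℤ) : ℝ) * v.coeff i := by
        intro i
        rw [coeff_sub, comp_C_mul_X_coeff, coeff_smul, zsmul_eq_mul]
        push_cast
        ring
      refine ih _ ?_ (sub_mem (comp_two_mul_X_mem hv) (zsmul_mem hv (2 ^ e : ℤ))) ?_ rfl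
      · rw [← hN]
        refine card_lt_card ((ssubset_iff_of_subset fun i hi => ?_).2 ⟨e, he, ?_⟩)
        · rw [mem_support_iff, hcoeff] at hi
          exact mem_support_iff.2 (right_ne_zero_of_mul hi)
        · rw [mem_support_iff, hcoeff]
          simp
      · rw [hcoeff]
        refine hirr.intCast_mul (sub_ne_zero.2 fun h => hed ?_)
        exact (Nat.pow_right_injective le_rfl (by exact_mod_cast h)).symm
    · push Not at he
      refine ⟨v.coeff d, hirr, ?_⟩
      convert hv using 1
      ext i
      rw [coeff_C_mul, coeff_X_pow]
      split_ifs with h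
      · simp [h]
      · have : i ∉ v.support := fun hi => h (he i hi)
        rw [mul_zero, notMem_support_iff.1 this]

theorem zsmul_coe_ne_zero {α : ℝ} (hα : Irrational α) {c : ℤ} (hc : c ≠ 0) :
    c • (α : UnitAddCircle) ≠ 0 := by
  rw [← AddCircle.coe_zsmul]
  intro h
  obtain ⟨m, hm⟩ := (AddCircle.coe_eq_zero_iff 1).1 h
  refine hα.intCast_mul hc ⟨m, ?_⟩
  simpa using hm

theorem diffMoment_zero_zmultiplesHom {u : Ultrafilter ℤ} {e : ℕ} {s t : UnitAddCircle}
    (h : Tendsto (fun a : ℤ => a ^ e • s) u (𝓝 t)) :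
    diffMoment UnitAddCircle u 0 e (zmultiplesHom UnitAddCircle s) =
      zmultiplesHom UnitAddCircle t := by
  ext
  refine moment_apply_eq ?_
  change Tendsto _ (u : Filter ℤ) _
  simpa using h

theorem zmultiplesHom_zero : zmultiplesHom UnitAddCircle 0 = 0 := by
  ext
  simp

theorem diffMoment_apply_one {ℓ d : ℕ} {α : ℝ} {u : Ultrafilter ℤ}
    (h : C α * X ^ d ∈ nullPolys (diffLaw ℓ u)) :
    diffMoment UnitAddCircle u ℓ d (zmultiplesHom UnitAddCircle (α : UnitAddCircle)) 1 = 0 := by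
  rw [mem_nullPolys] at h
  simp only [coe_eval_C_mul_X_pow] at h
  refine moment_apply_eq ?_
  simpa using h

theorem C_mul_X_pow_notMem_of_even {ℓ d : ℕ} (hd : Even d) (hd0 : d ≠ 0) {α : ℝ}
    (hα : Irrational α) : C α * X ^ d ∉ nullDiffPolys ℓ := by
  intro hmem
  obtain ⟨u, hu, hlim⟩ := exists_ultrafilter_tendsto (m := 1) d (γ := fun _ => α)
    (fun k hk => by
      have hk0 : k 0 ≠ 0 := fun h => hk (funext fun i => by rw [Subsingleton.elim i 0, h]; rfl)
      simpa using hα.intCast_mul hk0)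
    (fun _ e => if e = d then (α : UnitAddCircle) else 0)
  have h := ((isMomentSeq_diffMoment (T := UnitAddCircle) u).apply_of_even hd hd0
    (x := zmultiplesHom UnitAddCircle (α : UnitAddCircle)) (fun e he hed => by
      rw [diffMoment_zero_zmultiplesHom (hlim 0 e he hed.le), if_neg hed.ne,
        zmultiplesHom_zero]) ℓ).2
  rw [diffMoment_zero_zmultiplesHom (hlim 0 d hd0 le_rfl), if_pos rfl] at h
  have h' := diffMoment_apply_one (mem_nullDiffPolys.1 hmem u hu)
  rw [h] at h'
  refine zsmul_coe_ne_zero hα (c := 2 ^ ℓ) (by positivity) ?_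
  simpa using h'

/-- The ultrafilter is chosen so that `n ^ 2` moves `α = γ 0` through a chain `γ 0, …, γ ℓ` modulo
`1`, and `n ^ f` moves `γ ℓ` to `α`. -/
theorem C_mul_X_pow_notMem_of_odd {ℓ f : ℕ} (hf : Odd f) {α : ℝ} (hα : Irrational α) :
    C α * X ^ (2 * ℓ + f) ∉ nullDiffPolys ℓ := by
  intro hmem
  have hf' := Nat.odd_iff.1 hf
  obtain ⟨γ, hγ0, hγ⟩ := exists_irrational_combinations hα ℓ
  let g : ℕ → UnitAddCircle := fun i => if h : i < ℓ + 1 then (γ ⟨i, h⟩ : UnitAddCircle) else 0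
  have hg : ∀ i, ℓ < i → g i = 0 := fun i hi => dif_neg (by omega)
  have hg0 : g 0 = (α : UnitAddCircle) := by
    rw [← hγ0]
    exact dif_pos (Nat.succ_pos ℓ)
  let θ : ℕ → ℕ → UnitAddCircle := fun i e =>
    if i = ℓ ∧ e = f then (α : UnitAddCircle) else if e = 2 then g (i + 1) else 0
  obtain ⟨u, hu, hlim⟩ := exists_ultrafilter_tendsto (2 * ℓ + f) hγ fun i e => θ i e
  have hD : ∀ i e, e ≠ 0 → e ≤ 2 * ℓ + f →
      diffMoment UnitAddCircle u 0 e (zmultiplesHom UnitAddCircle (g i)) =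
        zmultiplesHom UnitAddCircle (θ i e) := by
    intro i e he hed
    refine diffMoment_zero_zmultiplesHom ?_
    rcases lt_or_ge i (ℓ + 1) with hi | hi
    · simp only [g, dif_pos hi]
      exact hlim ⟨i, hi⟩ e he hed
    · have hθ : θ i e = 0 := by
        simp only [θ]
        rw [if_neg (by omega), hg (i + 1) (by omega), ite_self]
      rw [hθ, hg i (by omega)]
      simp
  have hchain : IsChain (diffMoment UnitAddCircle u) ℓ (2 * ℓ + f)
      fun i => zmultiplesHom UnitAddCircle (g i) := by
    refine ⟨fun i hi => ?_, fun i e he he2 hed => ?_,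
      fun i hi => by rw [hg i hi, zmultiplesHom_zero]⟩
    · rw [hD i 2 two_ne_zero (by omega)]
      simp only [θ]
      rw [if_neg (by omega), if_pos trivial]
    · rw [hD i e he (by omega)]
      simp only [θ]
      rw [if_neg (by omega), if_neg he2, zmultiplesHom_zero]
  obtain ⟨c, hc, h⟩ := hchain.exists_smul (isMomentSeq_diffMoment u) hf
  have h' := diffMoment_apply_one (mem_nullDiffPolys.1 hmem u hu)
  rw [← hg0, h, hD ℓ f (by omega) (by omega)] at h'
  refine zsmul_coe_ne_zero hα hc ?_
  simpa [θ] using h'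

/-- A polynomial that vanishes modulo `1` along all iterated differences is the sum of an odd
polynomial of degree at most `2 * ℓ - 1` and a rational polynomial with integral constant term. -/
theorem exists_rational_of_mem_nullDiffPolys {ℓ : ℕ} (hℓ : 1 ≤ ℓ) {v : ℝ[X]}
    (hv : v ∈ nullDiffPolys ℓ) : ∃ w : ℚ[X], (∃ c : ℤ, w.eval 0 = (c : ℚ)) ∧
      IsOddPoly (v - w.map (algebraMap ℚ ℝ)) ∧
        (v - w.map (algebraMap ℚ ℝ)).natDegree ≤ 2 * ℓ - 1 := by
  have hrat : ∀ i, ∃ ρ : ℚ, (i = 0 ∨ Odd i ∧ i + 1 ≤ 2 * ℓ → ρ = 0) ∧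
      (¬ (i = 0 ∨ Odd i ∧ i + 1 ≤ 2 * ℓ) → (ρ : ℝ) = v.coeff i) := by
    intro i
    by_cases hi : i = 0 ∨ Odd i ∧ i + 1 ≤ 2 * ℓ
    · exact ⟨0, fun _ => rfl, fun h => absurd hi h⟩
    · have hnot : ¬ Irrational (v.coeff i) := by
        intro hirr
        obtain ⟨α, hα, hmem⟩ := exists_monomial_mem hv hirr
        push Not at hi
        rcases Nat.even_or_odd i with h | h
        · exact C_mul_X_pow_notMem_of_even h hi.1 hα hmem
        · have h1 := hi.2 h
          have h2 := Nat.odd_iff.1 h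
          rw [show i = 2 * ℓ + (i - 2 * ℓ) by omega] at hmem
          exact C_mul_X_pow_notMem_of_odd (Nat.odd_iff.2 (by omega)) hα hmem
      rw [Irrational, not_not] at hnot
      obtain ⟨ρ, hρ⟩ := hnot
      exact ⟨ρ, fun h => absurd h hi, fun _ => hρ⟩
  choose ρ hρ0 hρ using hrat
  let w : ℚ[X] := ∑ i ∈ range (v.natDegree + 1), C (ρ i) * X ^ i
  have hρdeg : ∀ i, v.natDegree < i → ρ i = 0 := by
    intro i hi
    by_cases h : i = 0 ∨ Odd i ∧ i + 1 ≤ 2 * ℓ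
    · exact hρ0 i h
    · have := hρ i h
      rw [coeff_eq_zero_of_natDegree_lt hi] at this
      exact_mod_cast this
  have hw : ∀ i, w.coeff i = ρ i := by
    intro i
    simp only [w, finsetSum_coeff, coeff_C_mul, coeff_X_pow]
    simp only [mul_ite, mul_one, mul_zero, sum_ite_eq, mem_range]
    split_ifs with h
    · rfl
    · exact (hρdeg i (by omega)).symm
  have hcoeff : ∀ i, ¬ (Odd i ∧ i + 1 ≤ 2 * ℓ) →
      (v - C (v.coeff 0) - w.map (algebraMap ℚ ℝ)).coeff i = 0 := by
    intro i hi
    rw [coeff_sub, coeff_sub, coeff_map, hw]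
    rcases eq_or_ne i 0 with rfl | hi0
    · simp [hρ0 0 (Or.inl rfl)]
    · rw [coeff_C_of_ne_zero hi0, ← hρ i (by tauto)]
      simp
  have hodd : IsOddPoly (v - C (v.coeff 0) - w.map (algebraMap ℚ ℝ)) :=
    isOddPoly_iff.2 fun i hi => hcoeff i fun h => Nat.not_even_iff_odd.2 h.1 hi
  have hdeg : (v - C (v.coeff 0) - w.map (algebraMap ℚ ℝ)).natDegree ≤ 2 * ℓ - 1 :=
    natDegree_le_iff_coeff_eq_zero.2 fun i hi => hcoeff i (by omega)
  have hw0 : w.eval 0 = ((0 : ℤ) : ℚ) := by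
    rw [← coeff_zero_eq_eval_zero, hw, hρ0 0 (Or.inl rfl), Int.cast_zero]
  obtain ⟨c, hc⟩ : ∃ c : ℤ, (c : ℝ) = v.coeff 0 := by
    -- `v - v(0)` vanishes modulo `1` along iterated differences, hence so does the constant `v(0)`
    have h0 := sub_mem hv (mem_nullDiffPolys_of_odd_add_rational hℓ hw0 hodd hdeg)
    rw [sub_sub_cancel] at h0
    obtain ⟨u, hu⟩ := Ultrafilter.exists_le (atTop : Filter ℤ)
    have h1 := mem_nullDiffPolys.1 h0 u hu
    simp only [mem_nullPolys, eval_C] at h1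
    obtain ⟨c, hc⟩ := (AddCircle.coe_eq_zero_iff 1).1 (tendsto_nhds_unique tendsto_const_nhds h1)
    exact ⟨c, by simpa using hc⟩
  have hsub : v - (w + C (c : ℚ)).map (algebraMap ℚ ℝ) =
      v - C (v.coeff 0) - w.map (algebraMap ℚ ℝ) := by
    rw [Polynomial.map_add, map_C, ← hc, eq_ratCast, Rat.cast_intCast]
    ring
  refine ⟨w + C (c : ℚ), ⟨c, ?_⟩, by rwa [hsub], by rwa [hsub]⟩
  rw [eval_add, hw0, eval_C, Int.cast_zero, zero_add]

/-! ### Return sets -/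

theorem notMem_toIntSet_returnSet {v : ℝ[X]} {ε : ℝ} {a : ℤ}
    (h : ¬ distNearestInt (v.eval (a : ℝ)) < ε) : a ∉ toIntSet (returnSet v ε) := by
  rintro ⟨m, hm, rfl⟩
  exact h (by simpa [returnSet] using hm)

theorem mem_nullDiffPolys_of_isDeltaStar {ℓ : ℕ} {v : ℝ[X]}
    (h : ∀ ε : ℝ, 0 < ε → IsDeltaStar ℓ (returnSet v ε)) : v ∈ nullDiffPolys ℓ := by
  refine mem_nullDiffPolys.2 fun u hu => mem_nullPolys_iff_distNearestInt.2 fun ε hε => ?_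
  by_contra hnot
  rw [← Ultrafilter.eventually_not] at hnot
  obtain ⟨φ, hφ, hφpos, hφP⟩ := exists_strictMono_forall_iterDiff hu
    (S := Set.Ioi 0) (hu (Ioi_mem_atTop 0)) hnot
  let n : ℕ → ℕ+ := fun k => ⟨(φ k).toNat, by have : 0 < φ k := hφpos k; omega⟩
  have hn : ∀ k, ((n k : ℕ) : ℤ) = φ k := fun k => Int.toNat_of_nonneg (le_of_lt (hφpos k))
  obtain ⟨x, ⟨j, hj, rfl⟩, hx⟩ := h ε hε n fun a b hab => by
    rw [← PNat.coe_lt_coe]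
    zify
    rw [hn, hn]
    exact hφ hab
  simp only [hn] at hx
  exact notMem_toIntSet_returnSet (hφP j hj) hx

/-- An increasing sequence of positive integers has a subsequence with positive iterated
differences, which form a finite difference set. -/
theorem IsDeltaStar.of_isDeltaFinStar {ℓ r : ℕ} {E : Set ℕ+} (h : IsDeltaFinStar ℓ r E) :
    IsDeltaStar ℓ E := by
  intro n hn
  let N : ℕ → ℤ := fun k => ((n k : ℕ) : ℤ)
  have hN : StrictMono N := fun a b hab => by simpa [N] using hn hab
  have hu : (((hyperfilter ℕ).map N : Ultrafilter ℤ) : Filter ℤ) ≤ atTop := by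
    rw [Ultrafilter.coe_map]
    have h1 : StrictMono fun k => (n k : ℕ) := fun a b hab => hn hab
    exact ((tendsto_natCast_atTop_atTop (R := ℤ)).comp h1.tendsto_atTop).mono_left
      Nat.hyperfilter_le_atTop
  obtain ⟨φ, hφ, hφN, hφpos⟩ := exists_strictMono_forall_iterDiff hu (S := Set.range N)
    (Ultrafilter.mem_map.2 (Filter.univ_mem' fun k => ⟨k, rfl⟩)) (eventually_diffLaw_gt hu ℓ 0)
  choose ψ hψ using hφN
  have hψmono : StrictMono ψ := fun a b hab => by
    rw [← hN.lt_iff_lt, hψ, hψ]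
    exact hφ hab
  obtain ⟨m, hmE, j, hj, hmj⟩ := h {m | ((m : ℕ) : ℤ) ∈ diffSet ℓ fun i : Fin r => φ i}
    ⟨fun i : Fin r => φ i, by
      rintro x ⟨j, hj, rfl⟩
      have hpos := hφpos (fun i => (j i : ℕ)) fun a b hab => hj hab
      refine ⟨⟨(iterDiff ℓ fun i => φ (j i)).toNat, by omega⟩, ?_, Int.toNat_of_nonneg hpos.le⟩
      exact ⟨j, hj, Int.toNat_of_nonneg hpos.le⟩⟩
  refine ⟨_, ⟨fun i => ψ (j i), fun a b hab => hψmono (hj hab), rfl⟩, m, hmE, ?_⟩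
  rw [hmj]
  simp only [← hψ, N]

/-- From counterexamples of every length, the iterated differences of the sequence whose terms are
the functions `r ↦ n r k` contradict the vanishing of odd moments. -/
theorem exists_isDeltaFinStar {ℓ : ℕ} (hℓ : 1 ≤ ℓ) {v : ℝ[X]} {w : ℚ[X]} {c : ℤ}
    (hc : w.eval 0 = (c : ℚ)) (hodd : IsOddPoly (v - w.map (algebraMap ℚ ℝ)))
    (hdeg : (v - w.map (algebraMap ℚ ℝ)).natDegree ≤ 2 * ℓ - 1) {ε : ℝ} (hε : 0 < ε) :
    ∃ r : ℕ, 2 ^ ℓ ≤ r ∧ IsDeltaFinStar ℓ r (returnSet v ε) := by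
  by_contra! hcon
  have H : ∀ r, ∃ n : Fin r → ℤ, 2 ^ ℓ ≤ r →
      ∀ x ∈ diffSet ℓ n, ¬ distNearestInt (v.eval (x : ℝ)) < ε := by
    intro r
    by_cases hr : 2 ^ ℓ ≤ r
    · have h := hcon r hr
      simp only [IsDeltaFinStar, not_forall] at h
      obtain ⟨F, ⟨n, hn⟩, hF⟩ := h
      refine ⟨n, fun _ x hx hlt => hF ?_⟩
      obtain ⟨m, hm, rfl⟩ := hn hx
      exact ⟨m, by simpa [returnSet] using hlt, hm⟩
    · exact ⟨0, fun h => absurd h hr⟩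
  choose n hn using H
  let N : ℕ → ℕ → ℤ := fun k r => if h : k < r then n r ⟨k, h⟩ else 0
  let D := diffLaw ℓ ((hyperfilter ℕ).map N)
  let F : Filter ℤ := (D : Filter (ℕ → ℤ)).bind fun a => (hyperfilter ℕ : Filter ℕ).map fun r => a r
  have hF : ∀ (α : ℝ) (d : ℕ), Odd d → d + 1 ≤ 2 * ℓ → C α * X ^ d ∈ nullPolys F := by
    intro α d hd hdl
    -- reduction modulo `1` of `α * a r`, in the limit `r → ∞`
    let ψ : (ℕ → ℤ) →+ UnitAddCircle := AddMonoidHom.mk'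
      (fun a => ((hyperfilter ℕ).map fun r => a r • (α : UnitAddCircle)).lim) fun a b =>
        lim_map_eq (by
          simp only [Pi.add_apply, add_smul]
          exact (tendsto_lim_map _ _).add (tendsto_lim_map _ _))
    have h := tendsto_odd_pow_diffLaw hd hdl ((hyperfilter ℕ).map N) ψ
    rw [mem_nullPolys, tendsto_nhds]
    simp only [coe_eval_C_mul_X_pow]
    intro s hs hs0
    change ∀ᶠ a in (D : Filter (ℕ → ℤ)), ∀ᶠ r in (hyperfilter ℕ : Filter ℕ),
      a r ^ d • (α : UnitAddCircle) ∈ s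
    filter_upwards [h.eventually (hs.mem_nhds hs0)] with a ha
    exact (tendsto_lim_map (hyperfilter ℕ) fun r => (a ^ d) r • (α : UnitAddCircle)).eventually
      (hs.mem_nhds ha)
  have hv := mem_nullPolys_iff_distNearestInt.1
    (mem_nullPolys_of_odd_add_rational hℓ hF hc hodd hdeg) ε hε
  have hv' : ∀ᶠ a in (D : Filter (ℕ → ℤ)), ∀ᶠ r in (hyperfilter ℕ : Filter ℕ),
    distNearestInt (v.eval (a r : ℝ)) < ε := hv
  obtain ⟨a, ha, j, hj, -, rfl⟩ := (hv'.and (eventually_diffLaw_exists N ℓ 0)).exists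
  have hlarge : ∀ᶠ r in (hyperfilter ℕ : Filter ℕ), 2 ^ ℓ ≤ r ∧ ∑ i, j i < r :=
    Nat.hyperfilter_le_atTop ((eventually_ge_atTop _).and (eventually_gt_atTop _))
  obtain ⟨r, hr, hrℓ, hrj⟩ := (ha.and hlarge).exists
  have hjr : ∀ i, j i < r := fun i =>
    (single_le_sum (fun _ _ => Nat.zero_le _) (mem_univ i)).trans_lt hrj
  refine hn r hrℓ _ ⟨fun i => ⟨j i, hjr i⟩, fun a b hab => hj hab, rfl⟩ ?_
  simpa only [N, hjr, dif_pos] using hr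

end OddPoly

theorem theorem2 (ℓ : ℕ) (hℓ : 1 ≤ ℓ) (v : Polynomial ℝ) :
    List.TFAE
      [∃ w : Polynomial ℚ, (∃ c : ℤ, w.eval 0 = (c : ℚ)) ∧
          OddPoly.IsOddPoly (v - w.map (algebraMap ℚ ℝ)) ∧
          (v - w.map (algebraMap ℚ ℝ)).natDegree ≤ 2 * ℓ - 1,
        ∀ ε : ℝ, 0 < ε → ∃ r : ℕ, 2 ^ ℓ ≤ r ∧
          OddPoly.IsDeltaFinStar ℓ r (OddPoly.returnSet v ε),
        ∀ ε : ℝ, 0 < ε → OddPoly.IsDeltaStar ℓ (OddPoly.returnSet v ε)] := by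
  tfae_have 1 → 2
  | ⟨_, ⟨_, hc⟩, hodd, hdeg⟩, _, hε => OddPoly.exists_isDeltaFinStar hℓ hc hodd hdeg hε
  tfae_have 2 → 3
  | h, ε, hε =>
    let ⟨_, _, hr⟩ := h ε hε
    OddPoly.IsDeltaStar.of_isDeltaFinStar hr
  tfae_have 3 → 1
  | h => OddPoly.exists_rational_of_mem_nullDiffPolys hℓ
      (OddPoly.mem_nullDiffPolys_of_isDeltaStar h)
  tfae_finish
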